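/- **Setting.** Let $\dim\in\{2,3\}$ and let $\bar\Omega=\bar\Omega^s\cup\bar\Omega^d\subset\mathbb R^{\dim}$ be the bounded polygonal/polyhedral region made up of a Stokes and a Darcy region, with matching conforming simplicial triangulations $\mathcal T^s,\mathcal T^d$, $\mathcal T=\mathcal T^s\cup\mathcal T^d$. The triangulations are shape regular with constant $\sigma$: every $K\in\mathcal T$ contains a ball of diameter $h_K/\sigma$, where $h_K=\operatorname{diam}K$. Let $\mathcal F$, $\mathcal F^j$ be the sets of facets of $\mathcal T$, $\mathcal T^j$ ($j=s,d$), $\Gamma^I$ the interface (union of the facets in $\mathcal F^s\cap\mathcal F^d$), $\Gamma^s=\partial\Omega\cap\partial\Omega^s$, $n$ the outward unit normal of $K$ on $\partial K$, and $n^j$ the outward unit normal of $\Omega^j$ (on the boundary of $K\in\mathcal T^j$, that of $K$). Let $k_c\ge 0$, $k_f=k_c+1$. Put * $V_h=\{v: v|_K\in P_{k_f}(K)^{\dim}\}$, $\bar V_h=\{\bar v: \bar v|_F\in P_{k_f}(F)^{\dim},\ F\in\mathcal F^s;\ \bar v=0\text{ on }\Gamma^s\}$; * $Q_h=\{q: q|_K\in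 P_{k_f-1}(K),\ \int_\Omega q=0\}$, $\bar Q_h^j=\{\bar q: \bar q|_F\in P_{k_f}(F),\ F\in\mathcal F^j\}$; * $\boldsymbol C_h=C_h\times\bar C_h$ with $C_h=\{w:w|_K\in P_{k_c}(K)\}$, $\bar C_h=\{\bar w:\bar w|_F\in P_{k_c}(F),\ F\in\mathcal F\}$. **Discrete velocity.** Let $\mu(c)$ be Lipschitz with $0<\mu_*\le\mu\le\mu^*$, let $\kappa(x)$ be symmetric with $\kappa_*|\xi|^2\le\xi^T\kappa(x)\xi\le\kappa^*|\xi|^2$ on $\bar\Omega^d$ for constants $0<\kappa_*<\kappa^*$, $\mathbb K=\kappa/\mu(c)$; let $f^s(x,c),f^d(x,c)$ be Lipschitz in $c$ and square integrable in $x$; let $\gamma^\ell=\alpha/\sqrt{\tau^\ell\cdot\kappa\tau^\ell}$ with $\alpha>0$ and unit tangents $\tau^1,\dots,\tau^{\dim-1}$ on $\Gamma^I$; let $0\le g_i^n,g_p^n\in L^2(\Omega^d)$ with $\int_{\Omega^d}(g_i^n-g_p^n)=0$; let $\beta_s,\Delta t>0$, $u_h^{n-1}\in V_h$, $\boldsymbol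 c_h^{n-1}\in\boldsymbol C_h$. Let $u_h^n$ be the element velocity of a solution $(u_h^n,\bar u_h^n)\in V_h\times\bar V_h$, $(p_h^n,\bar p_h^{s,n},\bar p_h^{d,n})\in Q_h\times\bar Q_h^s\times\bar Q_h^d$ of: for all $(v,\bar v)\in V_h\times \bar V_h$ and $(q,\bar q^s,\bar q^d)\in Q_h\times\bar Q_h^s\times\bar Q_h^d$, writing $c=c_h^{n-1}$, $\bar c=\bar c_h^{n-1}$, $\boldsymbol u=(u_h^n,\bar u_h^n)$, $\boldsymbol v=(v,\bar v)$, $\boldsymbol p=(p_h^n,\bar p_h^{s,n},\bar p_h^{d,n})$, $\boldsymbol q=(q,\bar q^s,\bar q^d)$, $$\sum_{K\in\mathcal T^s}\int_K\tfrac{u_h^n-u_h^{n-1}}{\Delta t}\cdot v\,dx+a_h(\boldsymbol u,\boldsymbol v)+b_h(\boldsymbol p,\boldsymbol v)+b_h(\boldsymbol q,\boldsymbol u)=\sum_{K\in\mathcal T^s}\int_K f^s(c)\cdot v\,dx+\sum_{K\in\mathcal T^d}\int_K\Big(\mathbb K^{-1}(c)f^d(c)\cdot v+(g_p^n-g_i^n)q\Big)dx,$$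 where, with $\varepsilon(u)=(\nabla u+\nabla u^T)/2$, $$\begin{aligned}a_h(\boldsymbol u,\boldsymbol v)={}&\sum_{K\in\mathcal T^s}\Big[\int_K2\mu(c)\varepsilon(u):\varepsilon(v)\,dx+\int_{\partial K}\tfrac{2\beta_s\mu(c)}{h_K}(u-\bar u)\cdot(v-\bar v)\,ds-\int_{\partial K}2\mu(c)\varepsilon(u)n\cdot(v-\bar v)\,ds-\int_{\partial K}2\mu(c)\varepsilon(v)n\cdot(u-\bar u)\,ds\Big]\\&+\int_{\Omega^d}\mathbb K^{-1}(c)u\cdot v\,dx+\sum_{\ell=1}^{\dim-1}\int_{\Gamma^I}\gamma^\ell\mu(\bar c)(\bar u\cdot\tau^\ell)(\bar v\cdot\tau^\ell)\,ds,\\ b_h(\boldsymbol q,\boldsymbol v)={}&\sum_{j=s,d}\Big[-\sum_{K\in\mathcal T^j}\int_Kq\,\nabla\cdot v\,dx+\sum_{K\in\mathcal T^j}\int_{\partial K}\bar q^j\,v\cdot n^j\,ds-\int_{\Gamma^I}\bar q^j\,\bar v\cdot n^j\,ds\Big].\end{aligned}$$ **Transport form.** Let $d>0$, and let $D:\mathbb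 R^{\dim}\to\mathbb R^{\dim\times\dim}$ satisfy $D_{\min}|\xi|^2\le\xi^TD(u)\xi$, $|D(u)|\le C_D(1+|u|)$ and $|D(u)-D(v)|\le C_D|u-v|$ for all $u,v,\xi\in\mathbb R^{\dim}$, with constants $D_{\min},C_D>0$; put $\widetilde D(u)=d\,\mathbb I$ on elements of $\mathcal T^s$ and $\widetilde D(u)=D(u)$ on elements of $\mathcal T^d$. With $\partial K^{\rm in}=\{x\in\partial K:u\cdot n<0\}$ and $\boldsymbol c=(c,\bar c)$, $\boldsymbol w=(w,\bar w)$ let $$\begin{aligned}B_h^{tr}(u;\boldsymbol c,\boldsymbol w)=\sum_{K\in\mathcal T}\Big[&-\int_Kc\,u\cdot\nabla w\,dx+\int_{\partial K}c\,u\cdot n\,(w-\bar w)\,ds-\int_{\partial K^{\rm in}}u\cdot n\,(c-\bar c)(w-\bar w)\,ds\\&+\int_K\widetilde D(u)\nabla c\cdot\nabla w\,dx+\tfrac{\beta_{tr}}{h_K}\int_{\partial K}[\widetilde D(u)n](c-\bar c)\cdot(w-\bar w)n\,ds\\&-\int_{\partial K}[\widetilde D(u)\nabla c]\cdot n\,(w-\bar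 w)\,ds-\int_{\partial K}[\widetilde D(u)\nabla w]\cdot n\,(c-\bar c)\,ds\Big],\end{aligned}$$ $$|||\boldsymbol w|||_c^2=\sum_{K\in\mathcal T}\big(\|\nabla w\|_K^2+h_K^{-1}\|w-\bar w\|_{\partial K}^2\big).$$ **Theorem.** Let $M>0$. There is a constant $C_{tr}>0$ depending only on $d$, $D_{\min}$ and $M$, and a constant $\beta_0>0$ depending only on $d$, $D_{\min}$, $M$, $C_D$, $\dim$, $k_c$ and $\sigma$ (so both are independent of the mesh size, of $\Delta t$ and of $n$), such that whenever $\|u_h^n\|_{L^\infty(\Omega)}\le M$ (so that $\widetilde D(u_h^n)$ is uniformly bounded) and $\beta_{tr}>\beta_0$, $$B_h^{tr}(u_h^n;\boldsymbol w_h,\boldsymbol w_h)\ \ge\ C_{tr}\,|||\boldsymbol w_h|||_c^2+\frac12\sum_{K\in\mathcal T^d}\int_K(\nabla\cdot u_h^n)\,w_h^2\,dx\qquad\forall\,\boldsymbol w_h=(w_h,\bar w_h)\in\boldsymbol C_h.$$ -/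

import Mathlib

open MeasureTheory

namespace StokesDarcy

noncomputable section

/-- Points (and vectors) of `ℝ^m` with the Euclidean norm. -/
abbrev Pt (m : ℕ) := EuclideanSpace ℝ (Fin m)

/-- Real polynomials in the `m` coordinates. -/
abbrev MPoly (m : ℕ) := MvPolynomial (Fin m) ℝ

variable {m : ℕ}

/-- Value of a polynomial at a point. -/
def MPoly.val (p : MPoly m) (x : Pt m) : ℝ := MvPolynomial.eval (fun i => x i) p

/-- Gradient of a polynomial at a point. -/
def MPoly.grad (p : MPoly m) (x : Pt m) : Pt m :=
  WithLp.toLp 2 (fun i => MPoly.val (MvPolynomial.pderiv i p) x)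

/-- Value of a polynomial vector field. -/
def vval (u : Fin m → MPoly m) (x : Pt m) : Pt m := WithLp.toLp 2 (fun i => MPoly.val (u i) x)

/-- Divergence of a polynomial vector field. -/
def vdiv (u : Fin m → MPoly m) (x : Pt m) : ℝ :=
  ∑ i, MPoly.val (MvPolynomial.pderiv i (u i)) x

/-- Strain rate `ε(u) = (∇u + (∇u)ᵀ)/2` of a polynomial vector field. -/
def strain (u : Fin m → MPoly m) (x : Pt m) : Matrix (Fin m) (Fin m) ℝ :=
  fun i j => (MPoly.val (MvPolynomial.pderiv j (u i)) x
    + MPoly.val (MvPolynomial.pderiv i (u j)) x) / 2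

/-- Matrix-vector product on Euclidean space. -/
def mulE (A : Matrix (Fin m) (Fin m) ℝ) (v : Pt m) : Pt m :=
  WithLp.toLp 2 (A.mulVec (fun i => v i))

/-- Frobenius inner product `A : B`. -/
def frobInner (A B : Matrix (Fin m) (Fin m) ℝ) : ℝ := ∑ i, ∑ j, A i j * B i j

/-- Euclidean norm of a matrix. -/
def frobNorm (A : Matrix (Fin m) (Fin m) ℝ) : ℝ := Real.sqrt (∑ i, ∑ j, A i j ^ 2)

/-! ### Simplices (given by their vertex sets) and integrals over them -/

/-- The closed simplex with vertex set `K`. -/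
abbrev hull (K : Finset (Pt m)) : Set (Pt m) := convexHull ℝ (K : Set (Pt m))

/-- Diameter `h_K`. -/
def diamK (K : Finset (Pt m)) : ℝ := Metric.diam (hull K)

open scoped Classical in
/-- The facet of the simplex `K` opposite to its vertex `v`. -/
def opp (K : Finset (Pt m)) (v : Pt m) : Finset (Pt m) := K.erase v

/-- The outward unit normal of the simplex `K` on the facet opposite to `v`: the normalized
component, orthogonal to that facet, of the vector from `v` to the barycenter of the facet. -/
def outwardNormal (K : Finset (Pt m)) (v : Pt m) : Pt m :=
  let w : Pt m := (vectorSpan ℝ (opp K v : Set (Pt m)))ᗮ.starProjection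
    (((opp K v).card : ℝ)⁻¹ • (∑ x ∈ opp K v, x) - v)
  ‖w‖⁻¹ • w

/-- `∫_K f dx`. -/
def cellInt (K : Finset (Pt m)) (f : Pt m → ℝ) : ℝ := ∫ x in hull K, f x

/-- `∫_{A} f ds` with the `(m-1)`-dimensional surface measure. -/
def surfInt (A : Set (Pt m)) (f : Pt m → ℝ) : ℝ := ∫ x in A, f x ∂μHE[m - 1]

/-- `∫_{∂K} f ds`; the integrand may depend on the facet, the outward unit normal and the point. -/
def bdryInt (K : Finset (Pt m)) (f : Finset (Pt m) → Pt m → Pt m → ℝ) : ℝ :=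
  ∑ v ∈ K, surfInt (hull (opp K v)) (f (opp K v) (outwardNormal K v))

/-- `∫_{∂K^in} f ds`, where `∂K^in` is the part of `∂K` on which `b · n < 0`. -/
def inflowInt (K : Finset (Pt m)) (b : Pt m → Pt m)
    (f : Finset (Pt m) → Pt m → Pt m → ℝ) : ℝ :=
  ∑ v ∈ K, surfInt (hull (opp K v) ∩ {x | inner ℝ (b x) (outwardNormal K v) < 0})
    (f (opp K v) (outwardNormal K v))

/-! ### Meshes -/

/-- Matching simplicial triangulations of the Stokes and the Darcy region: a finite pure
`m`-dimensional simplicial complex in `ℝ^m` whose elements (the `m`-simplices) are divided into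
Stokes elements and Darcy elements. -/
structure Mesh (m : ℕ) where
  complex : Geometry.SimplicialComplex ℝ (Pt m)
  stokes : Finset (Finset (Pt m))
  darcy : Finset (Finset (Pt m))
  disj : ∀ K ∈ stokes, K ∉ darcy
  elements_iff : ∀ K, (K ∈ stokes ∨ K ∈ darcy) ↔ (K ∈ complex.faces ∧ K.card = m + 1)
  pure : ∀ s ∈ complex.faces, ∃ K, (K ∈ stokes ∨ K ∈ darcy) ∧ s ⊆ K

/-- The closed region covered by a collection of elements. -/
def region (S : Finset (Finset (Pt m))) : Set (Pt m) := ⋃ K ∈ S, hull K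

open scoped Classical in
/-- All facets of a collection of elements. -/
def facetsOf (S : Finset (Finset (Pt m))) : Finset (Finset (Pt m)) :=
  S.biUnion fun K => K.image fun v => opp K v

namespace Mesh

open scoped Classical in
/-- All elements, `𝒯 = 𝒯^s ∪ 𝒯^d`. -/
def elements (T : Mesh m) : Finset (Finset (Pt m)) := T.stokes ∪ T.darcy

/-- All facets. -/
def facets (T : Mesh m) : Finset (Finset (Pt m)) := facetsOf T.elements

open scoped Classical in
/-- The facets on the interface between the Stokes and the Darcy region. -/
def interface (T : Mesh m) : Finset (Finset (Pt m)) := facetsOf T.stokes ∩ facetsOf T.darcy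

open scoped Classical in
/-- Facets on the outer boundary: those that belong to exactly one element. -/
def IsBoundaryFacet (T : Mesh m) (F : Finset (Pt m)) : Prop :=
  F ∈ T.facets ∧ (T.elements.filter fun K => F ⊆ K).card = 1

/-- Shape regularity with constant `σ`: every element `K` contains a ball of diameter `h_K / σ`. -/
def ShapeRegular (T : Mesh m) (σ : ℝ) : Prop :=
  ∀ K ∈ T.elements, ∃ z : Pt m, Metric.closedBall z (diamK K / (2 * σ)) ⊆ hull K

end Mesh

/-! ### Discrete spaces

A piecewise polynomial function on the mesh is given by the family of its polynomials on the
elements; likewise for the functions on the facets, for which only the values of the polynomial on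
the facet are ever used. -/

/-- Polynomials of total degree at most `k`. -/
abbrev Pk (m k : ℕ) : Submodule ℝ (MPoly m) := MvPolynomial.restrictTotalDegree (Fin m) ℝ k

/-- Pairs `(w_h, w̄_h)` of scalar functions on elements and on facets. -/
structure Scalar (m : ℕ) where
  cell : Finset (Pt m) → MPoly m
  facet : Finset (Pt m) → MPoly m

/-- Pairs `(v_h, v̄_h)` of vector functions on elements and on facets. -/
structure Velocity (m : ℕ) where
  cell : Finset (Pt m) → Fin m → MPoly m
  facet : Finset (Pt m) → Fin m → MPoly m

/-- Triples `(q_h, q̄_h^s, q̄_h^d)`. -/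
structure Pressure (m : ℕ) where
  cell : Finset (Pt m) → MPoly m
  facetS : Finset (Pt m) → MPoly m
  facetD : Finset (Pt m) → MPoly m

/-- The concentration HDG space `C_h × C̄_h` of degree `k`. -/
def MemC (T : Mesh m) (k : ℕ) (w : Scalar m) : Prop :=
  (∀ K ∈ T.elements, w.cell K ∈ Pk m k) ∧ (∀ F ∈ T.facets, w.facet F ∈ Pk m k)

/-- The element velocity space `V_h` of degree `k`. -/
def MemVCell (T : Mesh m) (k : ℕ) (v : Finset (Pt m) → Fin m → MPoly m) : Prop :=
  ∀ K ∈ T.elements, ∀ i, v K i ∈ Pk m k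

/-- The velocity HDG space `V_h × V̄_h` of degree `k`; facet velocities live on the facets of the
Stokes elements and vanish on the part of these that lies on the outer boundary. -/
def MemV (T : Mesh m) (k : ℕ) (v : Velocity m) : Prop :=
  MemVCell T k v.cell ∧
  (∀ F ∈ facetsOf T.stokes, ∀ i, v.facet F i ∈ Pk m k) ∧
  (∀ F ∈ facetsOf T.stokes, T.IsBoundaryFacet F → ∀ x ∈ hull F, vval (v.facet F) x = 0)

/-- The pressure HDG space: element pressures of degree `k` with mean zero, facet pressures of
degree `k + 1` on the facets of each of the two regions. -/
def MemQ (T : Mesh m) (k : ℕ) (q : Pressure m) : Prop :=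
  (∀ K ∈ T.elements, q.cell K ∈ Pk m k) ∧
  (∑ K ∈ T.elements, cellInt K (q.cell K).val = 0) ∧
  (∀ F ∈ facetsOf T.stokes, q.facetS F ∈ Pk m (k + 1)) ∧
  (∀ F ∈ facetsOf T.darcy, q.facetD F ∈ Pk m (k + 1))

/-! ### Data of the Stokes/Darcy problem -/

/-- Data of the flow problem over the (closed) Stokes and Darcy regions `Ωs`, `Ωd`: viscosity
`μ(c)`, permeability `κ(x)`, body forces `f^s(x,c)`, `f^d(x,c)` and slip coefficient `α`. -/
structure FlowData (m : ℕ) (Ωs Ωd : Set (Pt m)) where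
  visc : ℝ → ℝ
  visc_lipschitz : ∃ L : ℝ, ∀ a b, |visc a - visc b| ≤ L * |a - b|
  visc_bounds : ∃ lo hi : ℝ, 0 < lo ∧ ∀ c, lo ≤ visc c ∧ visc c ≤ hi
  perm : Pt m → Matrix (Fin m) (Fin m) ℝ
  perm_measurable : ∀ i j, Measurable fun x => perm x i j
  perm_symm : ∀ x ∈ Ωd, (perm x).IsSymm
  perm_bounds : ∃ lo hi : ℝ, 0 < lo ∧ lo < hi ∧ ∀ x ∈ Ωd, ∀ ξ : Pt m,
    lo * ‖ξ‖ ^ 2 ≤ inner ℝ ξ (mulE (perm x) ξ) ∧ inner ℝ ξ (mulE (perm x) ξ) ≤ hi * ‖ξ‖ ^ 2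
  forceS : Pt m → ℝ → Pt m
  forceS_memLp : ∀ c, MemLp (fun x => forceS x c) 2 (volume.restrict Ωs)
  forceS_lipschitz : ∃ L : ℝ, ∀ x ∈ Ωs, ∀ a b, ‖forceS x a - forceS x b‖ ≤ L * |a - b|
  forceD : Pt m → ℝ → Pt m
  forceD_memLp : ∀ c, MemLp (fun x => forceD x c) 2 (volume.restrict Ωd)
  forceD_lipschitz : ∃ L : ℝ, ∀ x ∈ Ωd, ∀ a b, ‖forceD x a - forceD x b‖ ≤ L * |a - b|
  slip : ℝ
  slip_pos : 0 < slip

/-- Injection and production rates at one time level: nonnegative, square integrable on the Darcy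
region, and balanced. -/
structure AdmissibleWells (Ωd : Set (Pt m)) (gi gp : Pt m → ℝ) : Prop where
  inj_memLp : MemLp gi 2 (volume.restrict Ωd)
  prod_memLp : MemLp gp 2 (volume.restrict Ωd)
  inj_nonneg : ∀ᵐ x ∂(volume.restrict Ωd), 0 ≤ gi x
  prod_nonneg : ∀ᵐ x ∂(volume.restrict Ωd), 0 ≤ gp x
  balance : ∫ x in Ωd, (gi x - gp x) = 0

/-- Unit tangent vectors `τ^1, …, τ^{m-1}` on each interface facet. -/
def IsTangents (T : Mesh m) (τ : Finset (Pt m) → Fin (m - 1) → Pt m) : Prop :=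
  ∀ F ∈ T.interface, ∀ l, ‖τ F l‖ = 1 ∧ τ F l ∈ vectorSpan ℝ (F : Set (Pt m))

variable {Ωs Ωd : Set (Pt m)}

/-- `𝕂⁻¹(c)` at `x`, where `𝕂 = κ / μ(c)`. -/
def FlowData.resist (P : FlowData m Ωs Ωd) (c : ℝ) (x : Pt m) : Matrix (Fin m) (Fin m) ℝ :=
  ((P.visc c)⁻¹ • P.perm x)⁻¹

/-- `γ = α / √(t · κ t)` for a unit tangent `t`. -/
def FlowData.slipCoeff (P : FlowData m Ωs Ωd) (t : Pt m) (x : Pt m) : ℝ :=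
  P.slip / Real.sqrt (inner ℝ t (mulE (P.perm x) t))

/-! ### The discrete Stokes/Darcy problem -/

/-- `a_h^s(c; u, v)` with penalty parameter `β`. -/
def formAS (T : Mesh m) (P : FlowData m Ωs Ωd) (β : ℝ) (c : Scalar m) (u v : Velocity m) : ℝ :=
  (∑ K ∈ T.stokes, cellInt K fun x =>
      2 * P.visc ((c.cell K).val x) * frobInner (strain (u.cell K) x) (strain (v.cell K) x))
  + (∑ K ∈ T.stokes, bdryInt K fun F _ x =>
      2 * β * P.visc ((c.cell K).val x) / diamK K *
        inner ℝ (vval (u.cell K) x - vval (u.facet F) x) (vval (v.cell K) x - vval (v.facet F) x))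
  - (∑ K ∈ T.stokes, bdryInt K fun F n x =>
      2 * P.visc ((c.cell K).val x) *
        inner ℝ (mulE (strain (u.cell K) x) n) (vval (v.cell K) x - vval (v.facet F) x))
  - (∑ K ∈ T.stokes, bdryInt K fun F n x =>
      2 * P.visc ((c.cell K).val x) *
        inner ℝ (mulE (strain (v.cell K) x) n) (vval (u.cell K) x - vval (u.facet F) x))

/-- `a_h^d(c; u, v)`. -/
def formAD (T : Mesh m) (P : FlowData m Ωs Ωd) (c : Scalar m) (u v : Velocity m) : ℝ :=
  ∑ K ∈ T.darcy, cellInt K fun x =>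
    inner ℝ (mulE (P.resist ((c.cell K).val x) x) (vval (u.cell K) x)) (vval (v.cell K) x)

/-- `a_h^I(c̄; ū, v̄)`. -/
def formAI (T : Mesh m) (P : FlowData m Ωs Ωd) (τ : Finset (Pt m) → Fin (m - 1) → Pt m)
    (c : Scalar m) (u v : Velocity m) : ℝ :=
  ∑ l, ∑ F ∈ T.interface, surfInt (hull F) fun x =>
    P.slipCoeff (τ F l) x * P.visc ((c.facet F).val x) *
      inner ℝ (vval (u.facet F) x) (τ F l) * inner ℝ (vval (v.facet F) x) (τ F l)

/-- `b_h^j((p, p̄^j), v)`, where `S` is the set of elements of region `j`. -/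
def formB (S : Finset (Finset (Pt m))) (p pbar : Finset (Pt m) → MPoly m) (v : Velocity m) : ℝ :=
  -(∑ K ∈ S, cellInt K fun x => (p K).val x * vdiv (v.cell K) x)
  + ∑ K ∈ S, bdryInt K fun F n x => (pbar F).val x * inner ℝ (vval (v.cell K) x) n

open scoped Classical in
/-- `b_h^{I,j}(p̄^j, v̄) = -∫_{Γ^I} p̄^j v̄ · n^j ds`. Each interface facet lies in exactly one
element of region `j`, and `n^j` is the outward normal of that element. -/
def formBI (T : Mesh m) (S : Finset (Finset (Pt m))) (pbar : Finset (Pt m) → MPoly m)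
    (v : Velocity m) : ℝ :=
  -(∑ K ∈ S, bdryInt K fun F n x =>
      if F ∈ T.interface then (pbar F).val x * inner ℝ (vval (v.facet F) x) n else 0)

/-- `∑_{j=s,d} (b_h^j(p^j, v) + b_h^{I,j}(p̄^j, v̄))`. -/
def formBTotal (T : Mesh m) (p : Pressure m) (v : Velocity m) : ℝ :=
  (formB T.stokes p.cell p.facetS v + formBI T T.stokes p.facetS v)
  + (formB T.darcy p.cell p.facetD v + formBI T T.darcy p.facetD v)

/-- `B_h^{sd}(c; (u,p), (v,q))`. -/
def formBsd (T : Mesh m) (P : FlowData m Ωs Ωd) (τ : Finset (Pt m) → Fin (m - 1) → Pt m) (β : ℝ)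
    (c : Scalar m) (u : Velocity m) (p : Pressure m) (v : Velocity m) (q : Pressure m) : ℝ :=
  (formAS T P β c u v + formAD T P c u v + formAI T P τ c u v)
  + formBTotal T p v + formBTotal T q u

/-- `(u, p) = (u_h^n, p_h^n)` solves one step of the discrete Stokes/Darcy problem (element
velocities of degree `k + 1`, element pressures of degree `k`), given the previous velocity
`u0 = u_h^{n-1}`, the previous concentration `c0 = c_h^{n-1}`, the time step `dt` and the well
rates `gi`, `gp` at the new time level. -/
def SolvesFlow (T : Mesh m) (k : ℕ) (P : FlowData m Ωs Ωd)
    (τ : Finset (Pt m) → Fin (m - 1) → Pt m) (β dt : ℝ)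
    (u0 : Finset (Pt m) → Fin m → MPoly m) (c0 : Scalar m) (gi gp : Pt m → ℝ)
    (u : Velocity m) (p : Pressure m) : Prop :=
  MemV T (k + 1) u ∧ MemQ T k p ∧
  ∀ (v : Velocity m) (q : Pressure m), MemV T (k + 1) v → MemQ T k q →
    (∑ K ∈ T.stokes, cellInt K fun x =>
        inner ℝ (dt⁻¹ • (vval (u.cell K) x - vval (u0 K) x)) (vval (v.cell K) x))
      + formBsd T P τ β c0 u p v q
    = (∑ K ∈ T.stokes, cellInt K fun x =>
        inner ℝ (P.forceS x ((c0.cell K).val x)) (vval (v.cell K) x))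
      + (∑ K ∈ T.darcy, cellInt K fun x =>
        inner ℝ (mulE (P.resist ((c0.cell K).val x) x) (P.forceD x ((c0.cell K).val x)))
          (vval (v.cell K) x))
      + ∑ K ∈ T.darcy, cellInt K fun x => (gp x - gi x) * (q.cell K).val x

/-! ### The discrete transport form -/

/-- Assumptions on the diffusion-dispersion tensor `D(u)` of the Darcy region: uniform ellipticity
with constant `Dmin`, linear growth and Lipschitz continuity with constant `CD`. -/
structure IsDispersionTensor (D : Pt m → Matrix (Fin m) (Fin m) ℝ) (Dmin CD : ℝ) : Prop where
  elliptic : ∀ u ξ : Pt m, Dmin * ‖ξ‖ ^ 2 ≤ inner ℝ ξ (mulE (D u) ξ)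
  growth : ∀ u : Pt m, frobNorm (D u) ≤ CD * (1 + ‖u‖)
  lipschitz : ∀ u v : Pt m, frobNorm (D u - D v) ≤ CD * ‖u - v‖

open scoped Classical in
/-- `D̃(u)` on the element `K`: it is `d I` on Stokes elements and `D(u)` on Darcy elements. -/
def Dtilde (T : Mesh m) (d : ℝ) (D : Pt m → Matrix (Fin m) (Fin m) ℝ)
    (u : Finset (Pt m) → Fin m → MPoly m) (K : Finset (Pt m)) (x : Pt m) :
    Matrix (Fin m) (Fin m) ℝ :=
  if K ∈ T.stokes then d • (1 : Matrix (Fin m) (Fin m) ℝ) else D (vval (u K) x)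

/-- The advective form `B_h^a(u; c, w)`. -/
def formBa (T : Mesh m) (u : Finset (Pt m) → Fin m → MPoly m) (c w : Scalar m) : ℝ :=
  -(∑ K ∈ T.elements, cellInt K fun x =>
      (c.cell K).val x * inner ℝ (vval (u K) x) ((w.cell K).grad x))
  + (∑ K ∈ T.elements, bdryInt K fun F n x =>
      (c.cell K).val x * inner ℝ (vval (u K) x) n * ((w.cell K).val x - (w.facet F).val x))
  - ∑ K ∈ T.elements, inflowInt K (vval (u K)) fun F n x =>
      inner ℝ (vval (u K) x) n * ((c.cell K).val x - (c.facet F).val x)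
        * ((w.cell K).val x - (w.facet F).val x)

/-- The diffusive form `B_h^d(u; c, w)` with penalty parameter `β`. -/
def formBd (T : Mesh m) (d : ℝ) (D : Pt m → Matrix (Fin m) (Fin m) ℝ) (β : ℝ)
    (u : Finset (Pt m) → Fin m → MPoly m) (c w : Scalar m) : ℝ :=
  (∑ K ∈ T.elements, cellInt K fun x =>
      inner ℝ (mulE (Dtilde T d D u K x) ((c.cell K).grad x)) ((w.cell K).grad x))
  + (∑ K ∈ T.elements, β / diamK K * bdryInt K fun F n x =>
      inner ℝ (((c.cell K).val x - (c.facet F).val x) • mulE (Dtilde T d D u K x) n)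
        (((w.cell K).val x - (w.facet F).val x) • n))
  - (∑ K ∈ T.elements, bdryInt K fun F n x =>
      inner ℝ (mulE (Dtilde T d D u K x) ((c.cell K).grad x)) n
        * ((w.cell K).val x - (w.facet F).val x))
  - ∑ K ∈ T.elements, bdryInt K fun F n x =>
      inner ℝ (mulE (Dtilde T d D u K x) ((w.cell K).grad x)) n
        * ((c.cell K).val x - (c.facet F).val x)

/-- The transport form `B_h^{tr}(u; c, w) = B_h^a(u; c, w) + B_h^d(u; c, w)`. -/
def formBtr (T : Mesh m) (d : ℝ) (D : Pt m → Matrix (Fin m) (Fin m) ℝ) (β : ℝ)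
    (u : Finset (Pt m) → Fin m → MPoly m) (c w : Scalar m) : ℝ :=
  formBa T u c w + formBd T d D β u c w

/-- `|||w|||_c² = ∑_K (‖∇w‖_K² + h_K⁻¹ ‖w - w̄‖_{∂K}²)`. -/
def normCSq (T : Mesh m) (w : Scalar m) : ℝ :=
  ∑ K ∈ T.elements, ((cellInt K fun x => ‖(w.cell K).grad x‖ ^ 2)
    + (diamK K)⁻¹ * bdryInt K fun F _ x => ((w.cell K).val x - (w.facet F).val x) ^ 2)

end

end StokesDarcy

open StokesDarcy

/-!
The transport form is the sum of an advective and a diffusive form, and each is bounded below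
element by element.

**Advection.** On an element `K` the divergence theorem for the field `w² u` turns the cell term
into `½ ∫_K (∇·u) w² - ½ ∫_{∂K} u·n w²`. Together with the facet terms this gives
`½ ∫_K (∇·u) w² + ½ ∫_{∂K} |u·n| (w - w̄)² - ½ ∫_{∂K} u·n w̄²` (`advective_element` drops the second
term). Two properties of the discrete flow finish the argument. The facet pressures are rich
enough to contain the normal flux residual of the velocity on each facet, so testing with that
residual shows that the normal velocity is single valued across facets, agrees with the facet
velocity on the interface, and vanishes on the outer boundary; the contributions
`∫_{∂K} u·n w̄²` therefore cancel (`SolvesFlow.sum_bdryInt_flux_eq_zero`). On the interface this uses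
that the two adjacent elements lie on opposite sides (`Mesh.outwardNormal_eq_neg`). Likewise
the element pressures contain the divergence of the velocity, so `∇·u = 0` on Stokes elements
(`SolvesFlow.vdiv_ae_eq_zero`); the mean value constraint on pressures is harmless because total
flux and well rates balance.

**Diffusion.** By ellipticity the cell and penalty terms control `‖∇w‖_K²` and
`h_K⁻¹ ‖w - w̄‖_{∂K}²`. The two consistency terms are absorbed with Young's inequality and the
discrete trace inequality `‖∇w‖_{∂K}² ≤ C h_K⁻¹ ‖∇w‖_K²` once the penalty parameter is large
(`diffusive_element`). The coercivity constant is `min d Dmin / 2`; the bound `M` on the velocity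
enters only through the upper bound of the diffusion tensor, hence through the penalty threshold.

**Tools.** The divergence theorem on a simplex (`BaryCoords.cellInt_vdiv`) is proved for
derivatives along edges: lines parallel to the edge `a - a'` run from the facet opposite to `a` to
the facet opposite to `a'`, so Fubini along this direction (`volume_eq_map_sweep`) and the change of
variables between the two facets (`map_projAlong_restrict`) reduce it to the fundamental theorem of
calculus. The trace inequality (`exists_trace_inequality`) combines a bound of the surface
area, from the divergence theorem for `x - z` with `z` the center of an inscribed ball, with the
equivalence of norms on polynomials of bounded degree, transported by scaling.
-/

namespace StokesDarcy

noncomputable section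

variable {m : ℕ}

/-! ### Surface measure on hyperplanes -/

/-- The hyperplane through `p` with (not necessarily unit) normal vector `g`. -/
def hyperplane (g p : Pt m) : Set (Pt m) := {x | inner ℝ g (x - p) = 0}

lemma isClosed_hyperplane (g p : Pt m) : IsClosed (hyperplane g p) :=
  isClosed_eq (by fun_prop) continuous_const

lemma hyperplane_restrict_eq_map {g : Pt m} (hg : g ≠ 0) (p : Pt m) :
    (μHE[m - 1] : Measure (Pt m)).restrict (hyperplane g p) =
      (volume : Measure ((ℝ ∙ g)ᗮ : Submodule ℝ (Pt m))).map
        (fun y : ((ℝ ∙ g)ᗮ : Submodule ℝ (Pt m)) => (y : Pt m) + p) := by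
  have hiso : Isometry (fun y : ((ℝ ∙ g)ᗮ : Submodule ℝ (Pt m)) => (y : Pt m) + p) :=
    (IsometryEquiv.addRight p).isometry.comp isometry_subtype_coe
  have hrank : Module.finrank ℝ ((ℝ ∙ g)ᗮ : Submodule ℝ (Pt m)) = m - 1 := by
    have h1 := (ℝ ∙ g).finrank_add_finrank_orthogonal
    rw [finrank_span_singleton hg, finrank_euclideanSpace_fin] at h1
    omega
  have hrange : Set.range (fun y : ((ℝ ∙ g)ᗮ : Submodule ℝ (Pt m)) => (y : Pt m) + p)
      = hyperplane g p := by
    ext x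
    simp only [Set.mem_range, hyperplane, Set.mem_ofPred_eq]
    constructor
    · rintro ⟨y, rfl⟩
      simpa using Submodule.mem_orthogonal_singleton_iff_inner_right.1 y.2
    · intro h
      exact ⟨⟨x - p, Submodule.mem_orthogonal_singleton_iff_inner_right.2 h⟩, by simp⟩
  rw [← hrange, ← hiso.map_euclideanHausdorffMeasure, ← hrank,
    InnerProductSpace.euclideanHausdorffMeasure_eq_volume]

instance sFinite_hyperplane_restrict (g p : Pt m) [hg : Fact (g ≠ 0)] :
    SFinite ((μHE[m - 1] : Measure (Pt m)).restrict (hyperplane g p)) := by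
  rw [hyperplane_restrict_eq_map hg.out p]
  infer_instance

/-- Compact subsets of a hyperplane have finite surface measure. -/
lemma surface_lt_top_of_isCompact {g p : Pt m} (hg : g ≠ 0) {S : Set (Pt m)} (hS : IsCompact S)
    (hSg : S ⊆ hyperplane g p) : (μHE[m - 1] : Measure (Pt m)) S < ⊤ := by
  have h1 : (μHE[m - 1] : Measure (Pt m)) S
      = (μHE[m - 1] : Measure (Pt m)).restrict (hyperplane g p) S := by
    rw [Measure.restrict_apply hS.measurableSet, Set.inter_eq_left.2 hSg]
  have hiso : Isometry (fun y : ((ℝ ∙ g)ᗮ : Submodule ℝ (Pt m)) => (y : Pt m) + p) :=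
    (IsometryEquiv.addRight p).isometry.comp isometry_subtype_coe
  rw [h1, hyperplane_restrict_eq_map hg, Measure.map_apply hiso.continuous.measurable
    hS.measurableSet]
  exact (hiso.isClosedEmbedding.isCompact_preimage hS).measure_lt_top

/-- **Fubini along a transversal direction**: sweeping the hyperplane with normal `g` along `e`,
where `⟪g, e⟫ = 1`, recovers Lebesgue measure up to the factor `‖g‖⁻¹`. -/
lemma volume_eq_map_sweep {g e : Pt m} (p : Pt m) (hge : inner ℝ g e = 1) :
    (volume : Measure (Pt m)) = ‖g‖ₑ⁻¹ •
      ((volume : Measure ℝ).prod ((μHE[m - 1] : Measure (Pt m)).restrict (hyperplane g p))).map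
        (fun q => q.2 + q.1 • e) := by
  have hg : g ≠ 0 := by rintro rfl; simp at hge
  have : Fact (g ≠ 0) := ⟨hg⟩
  have hmeas : Measurable (fun q : ℝ × Pt m => q.2 + q.1 • e) := by fun_prop
  ext t ht
  set v : Pt m := (‖g‖ ^ 2)⁻¹ • g with hv
  have hng : ‖g‖ ≠ 0 := norm_ne_zero_iff.2 hg
  have hv0 : v ≠ 0 := smul_ne_zero (by positivity) hg
  have hnv : ‖v‖ₑ = ‖g‖ₑ⁻¹ := by
    rw [← ofReal_norm, ← ofReal_norm, ← ENNReal.ofReal_inv_of_pos (by positivity), hv, norm_smul]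
    congr 1
    rw [norm_inv, norm_pow, norm_norm]
    field_simp
  have h1 := EuclideanGeometry.euclideanHausdorffMeasure_eq_lintegral p hv0 ht
  rw [finrank_euclideanSpace_fin, EuclideanSpace.euclideanHausdorffMeasure_eq_volume] at h1
  rw [h1, hnv, Measure.smul_apply, Measure.map_apply hmeas ht, Measure.prod_apply (hmeas ht),
    smul_eq_mul]
  congr 1
  refine lintegral_congr fun x => ?_
  have hs : MeasurableSet (Prod.mk x ⁻¹' ((fun q : ℝ × Pt m => q.2 + q.1 • e) ⁻¹' t)) :=
    measurable_prodMk_left (hmeas ht)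
  rw [Measure.restrict_apply hs, ← measure_preimage_add_right (μHE[m - 1] : Measure (Pt m)) (x • e)]
  congr 1
  ext y
  have hspan : (ℝ ∙ v) = (ℝ ∙ g) := by
    rw [hv]
    exact Submodule.span_singleton_smul_eq (IsUnit.mk0 _ (by positivity)) g
  have h2 : inner ℝ g (y + x • e - (x • v + p)) = inner ℝ g (y - p) := by
    have : y + x • e - (x • v + p) = (y - p) + x • (e - v) := by module
    rw [this, inner_add_right, inner_smul_right (𝕜 := ℝ) g (e - v), inner_sub_right g e v, hge, hv,
      inner_smul_right, real_inner_self_eq_norm_sq]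
    field_simp
    ring
  simp only [Set.mem_preimage, Set.mem_inter_iff, SetLike.mem_coe, AffineSubspace.mem_mk',
    vadd_eq_add, vsub_eq_sub, hspan, Submodule.mem_orthogonal_singleton_iff_inner_right, h2,
    hyperplane, Set.mem_ofPred_eq]

/-- The projection along `e` onto the hyperplane through `p` with normal `g`, where
`⟪g, e⟫ = 1`. -/
def projAlong (g p e x : Pt m) : Pt m := x - (inner ℝ g (x - p) : ℝ) • e

lemma continuous_projAlong (g p e : Pt m) : Continuous (projAlong g p e) := by
  unfold projAlong; fun_prop

lemma projAlong_add_smul {g e : Pt m} (p : Pt m) (hge : inner ℝ g e = 1) (x : Pt m) (t : ℝ) :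
    projAlong g p e (x + t • e) = projAlong g p e x := by
  have : x + t • e - p = (x - p) + t • e := by module
  rw [projAlong, projAlong, this, inner_add_right, inner_smul_right, hge]
  module

/-- For a set invariant under translations along `e`, the area of its section by a transversal
hyperplane is read off from the volume of a slab of unit thickness along `e`. -/
lemma volume_slab_eq {g g' e : Pt m} (p p' : Pt m) (hge : inner ℝ g e = 1)
    (hge' : inner ℝ g' e = 1) {B : Set (Pt m)} (hB : MeasurableSet B)
    (hBe : ∀ x (t : ℝ), x + t • e ∈ B ↔ x ∈ B) :
    volume (B ∩ {x | inner ℝ g' (x - p') ∈ Set.Icc (0 : ℝ) 1})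
      = ‖g‖ₑ⁻¹ * (μHE[m - 1] : Measure (Pt m)).restrict (hyperplane g p) B := by
  have : Fact (g ≠ 0) := ⟨by rintro rfl; simp at hge⟩
  have hmeas : Measurable (fun q : ℝ × Pt m => q.2 + q.1 • e) := by fun_prop
  have hslab : MeasurableSet (B ∩ {x : Pt m | inner ℝ g' (x - p') ∈ Set.Icc (0 : ℝ) 1}) :=
    hB.inter ((isClosed_Icc.preimage (f := fun x : Pt m => inner ℝ g' (x - p'))
      (by fun_prop)).measurableSet)
  rw [volume_eq_map_sweep p hge, Measure.smul_apply, Measure.map_apply hmeas hslab,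
    Measure.prod_apply_symm (hmeas hslab), smul_eq_mul]
  congr 1
  rw [← lintegral_indicator_one hB]
  refine lintegral_congr fun y => ?_
  by_cases hy : y ∈ B
  · have : (fun x => (x, y)) ⁻¹' ((fun q : ℝ × Pt m => q.2 + q.1 • e) ⁻¹'
        (B ∩ {x : Pt m | inner ℝ g' (x - p') ∈ Set.Icc (0 : ℝ) 1}))
        = Set.Icc (-(inner ℝ g' (y - p'))) (1 - inner ℝ g' (y - p')) := by
      ext t
      have h2 : y + t • e - p' = (y - p') + t • e := by module
      simp only [Set.mem_preimage, Set.mem_inter_iff, hBe, hy, Set.mem_ofPred_eq, true_and, h2,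
        inner_add_right, inner_smul_right, hge', Set.mem_Icc]
      constructor <;> rintro ⟨h3, h4⟩ <;> constructor <;> linarith
    rw [this, Set.indicator_of_mem hy, Real.volume_Icc]
    simp
  · have : (fun x => (x, y)) ⁻¹' ((fun q : ℝ × Pt m => q.2 + q.1 • e) ⁻¹'
        (B ∩ {x : Pt m | inner ℝ g' (x - p') ∈ Set.Icc (0 : ℝ) 1})) = ∅ := by
      ext t
      simp [hBe, hy]
    rw [this, Set.indicator_of_notMem hy, measure_empty]

/-- **Change of variables between two hyperplanes**: projecting along `e`, areas scale by the ratio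
of the lengths of the normals `g` that are normalized by `⟪g, e⟫ = 1`. -/
lemma map_projAlong_restrict {g g' e : Pt m} (p p' : Pt m) (hge : inner ℝ g e = 1)
    (hge' : inner ℝ g' e = 1) :
    ‖g‖ₑ⁻¹ • ((μHE[m - 1] : Measure (Pt m)).restrict (hyperplane g p)).map (projAlong g' p' e)
      = ‖g'‖ₑ⁻¹ • (μHE[m - 1] : Measure (Pt m)).restrict (hyperplane g' p') := by
  have hmeas := (continuous_projAlong g' p' e).measurable
  ext A hA
  have hBe : ∀ x (t : ℝ), x + t • e ∈ projAlong g' p' e ⁻¹' A ↔ x ∈ projAlong g' p' e ⁻¹' A := by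
    intro x t
    rw [Set.mem_preimage, projAlong_add_smul p' hge', Set.mem_preimage]
  rw [Measure.smul_apply, Measure.smul_apply, Measure.map_apply hmeas hA, smul_eq_mul, smul_eq_mul,
    ← volume_slab_eq p p' hge hge' (hmeas hA) hBe,
    volume_slab_eq p' p' hge' hge' (hmeas hA) hBe,
    Measure.restrict_apply (hmeas hA), Measure.restrict_apply hA]
  congr 2
  ext x
  simp only [Set.mem_inter_iff, Set.mem_preimage, and_congr_left_iff]
  intro hx
  have : projAlong g' p' e x = x := by
    have hx' : inner ℝ g' (x - p') = 0 := hx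
    rw [projAlong, hx', zero_smul, sub_zero]
  rw [this]

/-! ### Polynomials -/

namespace MPoly

lemma continuous_val (p : MPoly m) : Continuous (MPoly.val p) := by
  unfold MPoly.val
  exact (MvPolynomial.continuous_eval p).comp (by fun_prop)

@[simp] lemma val_zero (x : Pt m) : MPoly.val (0 : MPoly m) x = 0 := by simp [MPoly.val]

@[simp] lemma val_add (p q : MPoly m) (x : Pt m) :
    MPoly.val (p + q) x = MPoly.val p x + MPoly.val q x := by simp [MPoly.val]

@[simp] lemma val_neg (p : MPoly m) (x : Pt m) : MPoly.val (-p) x = -MPoly.val p x := by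
  simp [MPoly.val]

@[simp] lemma val_sub (p q : MPoly m) (x : Pt m) :
    MPoly.val (p - q) x = MPoly.val p x - MPoly.val q x := by simp [MPoly.val]

@[simp] lemma val_mul (p q : MPoly m) (x : Pt m) :
    MPoly.val (p * q) x = MPoly.val p x * MPoly.val q x := by simp [MPoly.val]

@[simp] lemma val_smul (r : ℝ) (p : MPoly m) (x : Pt m) :
    MPoly.val (r • p) x = r * MPoly.val p x := by simp [MPoly.val, MvPolynomial.smul_eval]

@[simp] lemma val_C (r : ℝ) (x : Pt m) : MPoly.val (MvPolynomial.C r : MPoly m) x = r := by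
  simp [MPoly.val]

@[simp] lemma val_X (i : Fin m) (x : Pt m) : MPoly.val (MvPolynomial.X i : MPoly m) x = x i := by
  simp [MPoly.val]

@[simp] lemma val_sum {ι : Type*} (s : Finset ι) (p : ι → MPoly m) (x : Pt m) :
    MPoly.val (∑ i ∈ s, p i) x = ∑ i ∈ s, MPoly.val (p i) x := by simp [MPoly.val]

lemma continuous_grad (p : MPoly m) : Continuous (MPoly.grad p) := by
  unfold MPoly.grad
  have := fun i => continuous_val (MvPolynomial.pderiv i p)
  fun_prop

lemma inner_grad (p : MPoly m) (x e : Pt m) :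
    inner ℝ (MPoly.grad p x) e = ∑ i, MPoly.val (MvPolynomial.pderiv i p) x * e i := by
  simp [MPoly.grad, PiLp.inner_apply, mul_comm]

lemma hasDerivAt_line (p : MPoly m) (x e : Pt m) (t : ℝ) :
    HasDerivAt (fun s : ℝ => MPoly.val p (x + s • e)) (inner ℝ (MPoly.grad p (x + t • e)) e) t := by
  rw [inner_grad]
  induction p using MvPolynomial.induction_on with
  | C a => simpa using hasDerivAt_const t a
  | add p q hp hq => 
    have hfun : (fun s : ℝ => MPoly.val (p + q) (x + s • e))
        = (fun s : ℝ => MPoly.val p (x + s • e)) + fun s : ℝ => MPoly.val q (x + s • e) := by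
      ext s; simp
    rw [hfun]
    simpa [add_mul, Finset.sum_add_distrib] using hp.add hq
  | mul_X p i hp =>
    have hX : HasDerivAt (fun s : ℝ => (x + s • e) i) (e i) t := by
      simpa using ((hasDerivAt_id t).mul_const (e i)).const_add (x i)
    have h := hp.mul hX
    have hfun : (fun s : ℝ => MPoly.val (p * MvPolynomial.X i) (x + s • e))
        = (fun s : ℝ => MPoly.val p (x + s • e)) * fun s : ℝ => (x + s • e) i := by
      ext s; simp
    rw [hfun]
    have hsum : ∀ j, MPoly.val (MvPolynomial.pderiv j (p * MvPolynomial.X i)) (x + t • e) * e j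
        = MPoly.val (MvPolynomial.pderiv j p) (x + t • e) * e j * (x + t • e) i
          + if j = i then MPoly.val p (x + t • e) * e i else 0 := by
      intro j
      rw [Derivation.leibniz, MvPolynomial.pderiv_X]
      by_cases hji : j = i
      · subst hji
        simp only [Pi.single_eq_same, smul_eq_mul, mul_one, val_add, val_mul, val_X, if_true]
        ring
      · simp only [Pi.single_eq_of_ne (Ne.symm hji), smul_eq_mul, mul_zero, zero_add, val_mul,
          val_X, if_neg hji, add_zero]
        ring
    rw [Finset.sum_congr rfl fun j _ => hsum j, Finset.sum_add_distrib, ← Finset.sum_mul,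
      Finset.sum_ite_eq' Finset.univ i, if_pos (Finset.mem_univ i)]
    exact h

lemma pderiv_mem_Pk {k : ℕ} {p : MPoly m} (hp : p ∈ Pk m (k + 1)) (i : Fin m) :
    MvPolynomial.pderiv i p ∈ Pk m k := by
  rw [p.as_sum, map_sum]
  refine Submodule.sum_mem _ fun s hs => ?_
  rw [MvPolynomial.pderiv_monomial, MvPolynomial.mem_restrictTotalDegree]
  by_cases hsi : s i = 0
  · simp [hsi]
  refine (MvPolynomial.totalDegree_monomial_le _ _).trans ?_
  have h1 : s.degree ≤ k + 1 := by
    have h2 := MvPolynomial.le_totalDegree hs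
    have h3 := (MvPolynomial.mem_restrictTotalDegree _ _ _).1 hp
    rw [Finsupp.degree_eq_sum, ← Finsupp.sum_fintype _ (fun _ e => e) (by simp)]
    exact h2.trans h3
  have h4 : Finsupp.single i 1 ≤ s := by
    rw [Finsupp.single_le_iff]; omega
  have h5 : (s - Finsupp.single i 1).degree + 1 = s.degree := by
    conv_rhs => rw [← tsub_add_cancel_of_le h4]
    rw [map_add]; simp
  have h6 : ((s - Finsupp.single i 1).sum fun _ => id) = (s - Finsupp.single i 1).degree := by
    rw [Finsupp.degree_eq_sum]
    exact Finsupp.sum_fintype _ (fun _ => id) (by simp)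
  omega

lemma Pk_mono {k l : ℕ} (hkl : k ≤ l) {p : MPoly m} (hp : p ∈ Pk m k) : p ∈ Pk m l := by
  rw [MvPolynomial.mem_restrictTotalDegree] at hp ⊢
  exact hp.trans hkl

lemma C_mem_Pk (k : ℕ) (r : ℝ) : (MvPolynomial.C r : MPoly m) ∈ Pk m k := by
  rw [MvPolynomial.mem_restrictTotalDegree, MvPolynomial.totalDegree_C]
  exact Nat.zero_le k

/-- Substituting `z + h y` for the variable does not raise the degree. -/
lemma exists_rescale {k : ℕ} {p : MPoly m} (hp : p ∈ Pk m k) (z : Pt m) (h : ℝ) :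
    ∃ q ∈ Pk m k, ∀ y : Pt m, MPoly.val q y = MPoly.val p (z + h • y) := by
  refine ⟨∑ s ∈ p.support, MvPolynomial.C (p.coeff s) *
    ∏ i ∈ s.support, (MvPolynomial.C (z i) + MvPolynomial.C h * MvPolynomial.X i) ^ s i, ?_, ?_⟩
  · refine Submodule.sum_mem _ fun s hs => ?_
    rw [MvPolynomial.mem_restrictTotalDegree] at hp ⊢
    refine (MvPolynomial.totalDegree_mul _ _).trans ?_
    rw [MvPolynomial.totalDegree_C, zero_add]
    refine (MvPolynomial.totalDegree_finsetProd _ _).trans ?_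
    refine le_trans (Finset.sum_le_sum (g := fun i => s i) fun i _ => ?_)
      ((MvPolynomial.le_totalDegree hs).trans hp)
    refine (MvPolynomial.totalDegree_pow _ _).trans ?_
    have : (MvPolynomial.C (z i) + MvPolynomial.C h * MvPolynomial.X i : MPoly m).totalDegree
        ≤ 1 := by
      refine (MvPolynomial.totalDegree_add _ _).trans (max_le (by simp) ?_)
      refine (MvPolynomial.totalDegree_mul _ _).trans ?_
      simp
    exact (Nat.mul_le_mul_left _ this).trans (by simp)
  · intro y
    conv_rhs => rw [MPoly.val, MvPolynomial.eval_eq]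
    rw [val_sum]
    refine Finset.sum_congr rfl fun s _ => ?_
    rw [val_mul, val_C]
    simp [MPoly.val, map_prod]

end MPoly

lemma continuous_vval (u : Fin m → MPoly m) : Continuous (vval u) := by
  unfold vval
  have := fun i => MPoly.continuous_val (u i)
  fun_prop

lemma continuous_vdiv (u : Fin m → MPoly m) : Continuous (vdiv u) := by
  unfold vdiv
  have := fun i => MPoly.continuous_val (MvPolynomial.pderiv i (u i))
  fun_prop

lemma inner_vval (u : Fin m → MPoly m) (x e : Pt m) :
    inner ℝ (vval u x) e = ∑ i, MPoly.val (u i) x * e i := by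
  simp [vval, PiLp.inner_apply, mul_comm]

/-! ### Barycentric coordinates of a simplex -/

/-- `K` is the vertex set of a nondegenerate `m`-simplex in `ℝ^m`. -/
structure IsSimplex (K : Finset (Pt m)) : Prop where
  indep : AffineIndependent ℝ ((↑) : K → Pt m)
  card : K.card = m + 1

/-- Barycentric coordinates `x ↦ const v + ⟪grad v, x⟫` of the simplex with vertex set `K`, one for
each vertex `v`; `grad v` is the gradient of the coordinate that belongs to `v`. -/
structure BaryCoords (K : Finset (Pt m)) where
  const : Pt m → ℝ
  grad : Pt m → Pt m
  vertex_self : ∀ v ∈ K, const v + inner ℝ (grad v) v = 1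
  vertex_ne : ∀ v ∈ K, ∀ w ∈ K, v ≠ w → const v + inner ℝ (grad v) w = 0
  mem_hull_iff : ∀ x, x ∈ hull K ↔ ∀ v ∈ K, 0 ≤ const v + inner ℝ (grad v) x
  sum_eq_one : ∀ x : Pt m, ∑ v ∈ K, (const v + inner ℝ (grad v) x) = 1
  sum_smul : ∀ x : Pt m, ∑ v ∈ K, (const v + inner ℝ (grad v) x) • v = x

open scoped Classical in
lemma IsSimplex.nonempty_baryCoords {K : Finset (Pt m)} (hK : IsSimplex K) :
    Nonempty (BaryCoords K) := by
  have htot : affineSpan ℝ (Set.range ((↑) : K → Pt m)) = ⊤ := by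
    rw [hK.indep.affineSpan_eq_top_iff_card_eq_finrank_add_one]
    simp [hK.card]
  let b : AffineBasis K ℝ (Pt m) := ⟨(↑), hK.indep, htot⟩
  have hb : ∀ i : K, b i = (i : Pt m) := fun _ => rfl
  let L : K → (Pt m →L[ℝ] ℝ) := fun i => LinearMap.toContinuousLinearMap (b.coord i).linear
  let G : K → Pt m := fun i => (InnerProductSpace.toDual ℝ (Pt m)).symm (L i)
  have hG : ∀ (i : K) (x : Pt m), b.coord i 0 + inner ℝ (G i) x = b.coord i x := by
    intro i x
    have h1 : inner ℝ (G i) x = (b.coord i).linear x := by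
      simp [G, L, InnerProductSpace.toDual_symm_apply]
    have h2 := (b.coord i).map_vadd 0 x
    rw [h1, add_comm]
    simpa using h2.symm
  let c : Pt m → ℝ := fun v => if h : v ∈ K then b.coord ⟨v, h⟩ 0 else 0
  let g : Pt m → Pt m := fun v => if h : v ∈ K then G ⟨v, h⟩ else 0
  have hcg : ∀ (i : K) (x : Pt m), c i + inner ℝ (g i) x = b.coord i x := by
    intro i x
    rw [← hG]
    simp [c, g]
  have hcg' : ∀ v (hv : v ∈ K) (x : Pt m), c v + inner ℝ (g v) x = b.coord ⟨v, hv⟩ x :=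
    fun v hv x => hcg ⟨v, hv⟩ x
  have hrange : Set.range b = (K : Set (Pt m)) := by
    ext x; simp [hb]
  refine ⟨⟨c, g, ?_, ?_, ?_, ?_, ?_⟩⟩
  · intro v hv
    rw [hcg' v hv]
    exact b.coord_apply_eq ⟨v, hv⟩
  · intro v hv w hw hvw
    rw [hcg' v hv]
    exact b.coord_apply_ne (i := ⟨v, hv⟩) (j := ⟨w, hw⟩) (fun h => hvw (congrArg Subtype.val h))
  · intro x
    have h1 := b.convexHull_eq_nonneg_coord
    rw [hrange] at h1
    rw [hull, h1, Set.mem_ofPred_eq, Subtype.forall]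
    exact forall₂_congr fun v hv => by rw [hcg' v hv]
  · intro x
    rw [← Finset.sum_coe_sort]
    simp only [hcg]
    exact b.sum_coord_apply_eq_one x
  · intro x
    rw [← Finset.sum_coe_sort K (fun v => (c v + inner ℝ (g v) x) • v)]
    simp only [hcg]
    exact b.linear_combination_coord_eq_self x

namespace BaryCoords

variable {K : Finset (Pt m)} (b : BaryCoords K)

/-- The barycentric coordinate that belongs to the vertex `v`. -/
def lam (v x : Pt m) : ℝ := b.const v + inner ℝ (b.grad v) x

lemma lam_add_smul (v x e : Pt m) (t : ℝ) :
    b.lam v (x + t • e) = b.lam v x + t * inner ℝ (b.grad v) e := by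
  simp only [lam, inner_add_right, inner_smul_right]; ring

lemma inner_grad_sub (v x y : Pt m) : inner ℝ (b.grad v) (x - y) = b.lam v x - b.lam v y := by
  simp only [lam, inner_sub_right]; ring

lemma lam_self {v : Pt m} (hv : v ∈ K) : b.lam v v = 1 := b.vertex_self v hv

lemma lam_ne {v w : Pt m} (hv : v ∈ K) (hw : w ∈ K) (hvw : v ≠ w) : b.lam v w = 0 :=
  b.vertex_ne v hv w hw hvw

lemma mem_hull {x : Pt m} : x ∈ hull K ↔ ∀ v ∈ K, 0 ≤ b.lam v x := b.mem_hull_iff x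

lemma sum_lam (x : Pt m) : ∑ v ∈ K, b.lam v x = 1 := b.sum_eq_one x

lemma sum_lam_smul (x : Pt m) : ∑ v ∈ K, b.lam v x • v = x := b.sum_smul x

/-- Every vector is the combination of edges from `x` with the barycentric coordinates as
weights. -/
lemma sum_lam_smul_sub (x y : Pt m) : ∑ v ∈ K, b.lam v x • (v - y) = x - y := by
  simp only [smul_sub, Finset.sum_sub_distrib, ← Finset.sum_smul, sum_lam_smul, sum_lam, one_smul]

lemma mem_opp {v w : Pt m} : w ∈ opp K v ↔ w ≠ v ∧ w ∈ K := by
  classical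
  rw [opp, Finset.mem_erase]

lemma card_opp {v : Pt m} (hv : v ∈ K) : (opp K v).card + 1 = K.card := by
  classical
  rw [opp, Finset.card_erase_add_one hv]

lemma opp_subset (v : Pt m) : opp K v ⊆ K := fun _ hw => (mem_opp.1 hw).2

lemma hull_opp_subset (v : Pt m) : hull (opp K v) ⊆ hull K :=
  convexHull_mono (by exact_mod_cast opp_subset v)

/-- The facet opposite to `v` is the part of the simplex where the coordinate of `v` vanishes. -/
lemma mem_hull_opp {v : Pt m} (hv : v ∈ K) {x : Pt m} :
    x ∈ hull (opp K v) ↔ x ∈ hull K ∧ b.lam v x = 0 := by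
  constructor
  · intro hx
    refine ⟨hull_opp_subset v hx, ?_⟩
    have hconv : Convex ℝ {y : Pt m | b.lam v y = 0} := by
      have : {y : Pt m | b.lam v y = 0} = {y : Pt m | innerₗ (Pt m) (b.grad v) y = -b.const v} := by
        ext y
        simp only [lam, Set.mem_ofPred_eq, innerₗ_apply_apply]
        constructor <;> intro h <;> linarith
      rw [this]
      exact convex_hyperplane (innerₗ (Pt m) (b.grad v)).isLinear _
    exact convexHull_min (fun w hw => b.lam_ne hv (mem_opp.1 hw).2 (mem_opp.1 hw).1.symm) hconv hx
  · rintro ⟨hx, h0⟩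
    classical
    have h1 := b.sum_lam x
    have h2 := b.sum_lam_smul x
    rw [← Finset.sum_erase_add _ _ hv, h0, add_zero] at h1
    rw [← Finset.sum_erase_add _ _ hv, h0, zero_smul, add_zero] at h2
    rw [← h2]
    refine (convex_convexHull ℝ _).sum_mem (fun w hw => ?_) h1 (fun w hw => ?_)
    · exact b.mem_hull.1 hx w (Finset.mem_of_mem_erase hw)
    · refine subset_convexHull ℝ _ ?_
      have hw' := Finset.mem_erase.1 hw
      exact mem_opp.2 hw'

lemma grad_ne_zero {v w : Pt m} (hv : v ∈ K) (hw : w ∈ opp K v) : b.grad v ≠ 0 := by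
  intro h
  have h1 := b.inner_grad_sub v v w
  rw [h, b.lam_self hv, b.lam_ne hv (mem_opp.1 hw).2 (mem_opp.1 hw).1.symm] at h1
  simp at h1

lemma hull_opp_subset_hyperplane {v w : Pt m} (hv : v ∈ K) (hw : w ∈ opp K v) :
    hull (opp K v) ⊆ hyperplane (b.grad v) w := by
  intro x hx
  rw [hyperplane, Set.mem_ofPred_eq, b.inner_grad_sub, ((b.mem_hull_opp hv).1 hx).2,
    b.lam_ne hv (mem_opp.1 hw).2 (mem_opp.1 hw).1.symm, sub_zero]

lemma orthogonal_vectorSpan_opp {v : Pt m} (hv : v ∈ K) (hne : (opp K v).Nonempty) :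
    (vectorSpan ℝ (opp K v : Set (Pt m)))ᗮ = ℝ ∙ b.grad v := by
  obtain ⟨w₀, hw₀⟩ := hne
  set F := opp K v with hF
  set W := vectorSpan ℝ (F : Set (Pt m)) with hW
  have hlamF : ∀ w ∈ F, b.lam v w = 0 := fun w hw =>
    b.lam_ne hv (mem_opp.1 hw).2 (mem_opp.1 hw).1.symm
  have hgW : b.grad v ∈ Wᗮ := by
    rw [hW, vectorSpan_def, Submodule.mem_orthogonal']
    intro y hy
    induction hy using Submodule.span_induction with
    | mem y hy =>
      obtain ⟨a, ha, c, hc, rfl⟩ := Set.mem_vsub.1 hy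
      rw [vsub_eq_sub, b.inner_grad_sub, hlamF a (by exact_mod_cast ha),
        hlamF c (by exact_mod_cast hc), sub_zero]
    | zero => simp
    | add y z _ _ hy hz => rw [inner_add_right, hy, hz, add_zero]
    | smul r y _ hy => rw [inner_smul_right, hy, mul_zero]
  refine le_antisymm (fun y hy => ?_) ((Submodule.span_singleton_le_iff_mem _ _).2 hgW)
  rw [Submodule.mem_span_singleton]
  -- a normal vector is determined by its product with the edge from the facet to `v`
  refine ⟨inner ℝ y (v - w₀), ?_⟩
  rw [← sub_eq_zero]
  refine ext_inner_right ℝ fun x => ?_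
  rw [inner_zero_left]
  have hx : x = ∑ w ∈ K, b.lam w (x + w₀) • (w - w₀) := by
    rw [b.sum_lam_smul_sub, add_sub_cancel_right]
  rw [hx, inner_sum]
  refine Finset.sum_eq_zero fun w hw => ?_
  rw [inner_smul_right, inner_sub_left, inner_smul_left, b.inner_grad_sub, hlamF w₀ hw₀]
  by_cases hwv : w = v
  · subst hwv
    simp [b.lam_self hv]
  · have hwF : w ∈ F := mem_opp.2 ⟨hwv, hw⟩
    have : inner ℝ y (w - w₀) = 0 := by
      rw [real_inner_comm]
      exact (Submodule.mem_orthogonal W y).1 hy _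
        (vsub_mem_vectorSpan ℝ (by exact_mod_cast hwF) (by exact_mod_cast hw₀))
    simp [hlamF w hwF, this]

/-- The outward unit normal points against the gradient of the barycentric coordinate of the
opposite vertex. -/
lemma outwardNormal_eq {v : Pt m} (hv : v ∈ K) (hne : (opp K v).Nonempty) :
    outwardNormal K v = -(‖b.grad v‖⁻¹ • b.grad v) := by
  have hspan := b.orthogonal_vectorSpan_opp hv hne
  obtain ⟨w₀, hw₀⟩ := hne
  have hng : ‖b.grad v‖ ≠ 0 := norm_ne_zero_iff.2 (b.grad_ne_zero hv hw₀)
  set F := opp K v with hF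
  set W := vectorSpan ℝ (F : Set (Pt m)) with hW
  have hlamF : ∀ w ∈ F, b.lam v w = 0 := fun w hw =>
    b.lam_ne hv (mem_opp.1 hw).2 (mem_opp.1 hw).1.symm
  set z : Pt m := (F.card : ℝ)⁻¹ • (∑ x ∈ F, x) - v with hz
  have hcard : (F.card : ℝ) ≠ 0 := by
    exact_mod_cast Finset.card_ne_zero_of_mem hw₀
  have hz1 : inner ℝ (b.grad v) z = -1 := by
    have h1 : z = (F.card : ℝ)⁻¹ • ∑ x ∈ F, (x - v) := by
      rw [Finset.sum_sub_distrib, Finset.sum_const, hz, smul_sub, ← Nat.cast_smul_eq_nsmul ℝ,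
        smul_smul, inv_mul_cancel₀ hcard, one_smul]
    rw [h1, inner_smul_right, inner_sum, Finset.sum_congr rfl (g := fun _ => (-1 : ℝ))
      (fun x hx => by rw [b.inner_grad_sub, hlamF x hx, b.lam_self hv, zero_sub])]
    simp [hcard]
  have hproj : Wᗮ.starProjection z = -((‖b.grad v‖ ^ 2)⁻¹ • b.grad v) := by
    have h2 : Wᗮ.starProjection z = (ℝ ∙ b.grad v).starProjection z := by
      congr! 2
    rw [h2, Submodule.starProjection_singleton, hz1]
    simp [div_eq_mul_inv]
  have hout : outwardNormal K v = ‖Wᗮ.starProjection z‖⁻¹ • Wᗮ.starProjection z := rfl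
  rw [hout, hproj, norm_neg, norm_smul, smul_neg, smul_smul]
  congr 2
  rw [norm_inv, norm_pow, norm_norm]
  field_simp

lemma norm_outwardNormal (b : BaryCoords K) {v : Pt m} (hv : v ∈ K) (hne : (opp K v).Nonempty) :
    ‖outwardNormal K v‖ = 1 := by
  obtain ⟨w₀, hw₀⟩ := id hne
  have hng : ‖b.grad v‖ ≠ 0 := norm_ne_zero_iff.2 (b.grad_ne_zero hv hw₀)
  rw [b.outwardNormal_eq hv hne, norm_neg, norm_smul, norm_inv, norm_norm, inv_mul_cancel₀ hng]

end BaryCoords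

/-! ### The divergence theorem on a simplex -/

lemma isCompact_hull (K : Finset (Pt m)) : IsCompact (hull K) :=
  K.finite_toSet.isCompact_convexHull ℝ

lemma measurableSet_hull (K : Finset (Pt m)) : MeasurableSet (hull K) :=
  (isCompact_hull K).measurableSet

namespace BaryCoords

variable {K : Finset (Pt m)}

lemma surface_facet_lt_top (b : BaryCoords K) {v : Pt m} (hv : v ∈ K) (hne : (opp K v).Nonempty) :
    (μHE[m - 1] : Measure (Pt m)) (hull (opp K v)) < ⊤ := by
  obtain ⟨w, hw⟩ := hne
  exact surface_lt_top_of_isCompact (b.grad_ne_zero hv hw) (isCompact_hull _)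
    (b.hull_opp_subset_hyperplane hv hw)

lemma integrableOn_facet (b : BaryCoords K) {v : Pt m} (hv : v ∈ K) (hne : (opp K v).Nonempty)
    {f : Pt m → ℝ} (hf : Continuous f) :
    IntegrableOn f (hull (opp K v)) (μHE[m - 1] : Measure (Pt m)) := by
  obtain ⟨C, hC⟩ := (isCompact_hull (opp K v)).exists_bound_of_continuousOn hf.continuousOn
  refine Measure.integrableOn_of_bounded (b.surface_facet_lt_top hv hne).ne
    hf.aestronglyMeasurable (M := C) ?_
  exact (ae_restrict_iff' (measurableSet_hull _)).2 (Filter.Eventually.of_forall hC)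

lemma inner_grad_edge (b : BaryCoords K) {v w w' : Pt m} (hv : v ∈ K) (hw : w ∈ K) (hw' : w' ∈ K)
    (h : v ≠ w) (h' : v ≠ w') : inner ℝ (b.grad v) (w - w') = 0 := by
  rw [b.inner_grad_sub, b.lam_ne hv hw h, b.lam_ne hv hw' h', sub_zero]

lemma inner_grad_edge_self (b : BaryCoords K) {v w : Pt m} (hv : v ∈ K) (hw : w ∈ K) (h : v ≠ w) :
    inner ℝ (b.grad v) (v - w) = 1 := by
  rw [b.inner_grad_sub, b.lam_self hv, b.lam_ne hv hw h, sub_zero]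

/-- Lines parallel to the edge `a - a'` meet the simplex in segments running from the facet opposite
to `a` to the facet opposite to `a'`. -/
lemma add_smul_edge_mem_hull (b : BaryCoords K) {a a' : Pt m} (ha : a ∈ K) (ha' : a' ∈ K)
    (haa : a ≠ a') {y : Pt m} (hy : b.lam a y = 0) (t : ℝ) :
    y + t • (a - a') ∈ hull K ↔ y ∈ hull (opp K a) ∧ t ∈ Set.Icc 0 (b.lam a' y) := by
  have h1 : b.lam a (y + t • (a - a')) = t := by
    rw [b.lam_add_smul, hy, b.inner_grad_edge_self ha ha' haa]; ring
  have h2 : b.lam a' (y + t • (a - a')) = b.lam a' y - t := by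
    rw [b.lam_add_smul, ← neg_sub a' a, inner_neg_right, b.inner_grad_edge_self ha' ha haa.symm]
    ring
  have h3 : ∀ v ∈ K, v ≠ a → v ≠ a' → b.lam v (y + t • (a - a')) = b.lam v y := by
    intro v hv hva hva'
    rw [b.lam_add_smul, b.inner_grad_edge hv ha ha' hva hva', mul_zero, add_zero]
  rw [b.mem_hull_opp ha, b.mem_hull, b.mem_hull]
  constructor
  · intro h
    have ht := h a ha
    have ht' := h a' ha'
    rw [h1] at ht
    rw [h2] at ht'
    refine ⟨⟨fun v hv => ?_, hy⟩, ht, by linarith⟩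
    by_cases hva : v = a
    · rw [hva, hy]
    by_cases hva' : v = a'
    · rw [hva']; linarith
    rw [← h3 v hv hva hva']
    exact h v hv
  · rintro ⟨⟨h, -⟩, ht, ht'⟩ v hv
    by_cases hva : v = a
    · rw [hva, h1]; exact ht
    by_cases hva' : v = a'
    · rw [hva', h2]; linarith
    rw [h3 v hv hva hva']
    exact h v hv

/-- The divergence theorem for a derivative along an edge: only the two facets opposite to its end
points contribute. -/
lemma cellInt_grad_edge (b : BaryCoords K) {a a' : Pt m} (ha : a ∈ K) (ha' : a' ∈ K)
    (haa : a ≠ a') (p : MPoly m) :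
    cellInt K (fun x => inner ℝ (MPoly.grad p x) (a - a'))
      = ‖b.grad a'‖⁻¹ * surfInt (hull (opp K a')) (MPoly.val p)
        - ‖b.grad a‖⁻¹ * surfInt (hull (opp K a)) (MPoly.val p) := by
  set e : Pt m := a - a' with he
  have hpc : Continuous (MPoly.val p) := MPoly.continuous_val p
  have hge : inner ℝ (b.grad a) e = 1 := b.inner_grad_edge_self ha ha' haa
  have hge' : inner ℝ (-b.grad a') e = 1 := by
    rw [he, ← neg_sub a' a, inner_neg_neg, b.inner_grad_edge_self ha' ha haa.symm]
  have hmem : a' ∈ opp K a := mem_opp.2 ⟨haa.symm, ha'⟩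
  have hmem' : a ∈ opp K a' := mem_opp.2 ⟨haa, ha⟩
  have hg0 : b.grad a ≠ 0 := b.grad_ne_zero ha hmem
  have hg0' : b.grad a' ≠ 0 := b.grad_ne_zero ha' hmem'
  have : Fact (b.grad a ≠ 0) := ⟨hg0⟩
  set ν := (μHE[m - 1] : Measure (Pt m)).restrict (hyperplane (b.grad a) a') with hν
  set ν' := (μHE[m - 1] : Measure (Pt m)).restrict (hyperplane (-b.grad a') a) with hν'
  have hfac : ∀ g : Pt m, (‖g‖ₑ⁻¹).toReal = ‖g‖⁻¹ := fun g => by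
    rw [ENNReal.toReal_inv, toReal_enorm]
  have htop : ∀ g : Pt m, g ≠ 0 → ‖g‖ₑ⁻¹ ≠ ⊤ := fun g hg => by simpa using hg
  -- the integrand, extended by zero, and its integral by Fubini along `e`
  set G : Pt m → ℝ := (hull K).indicator (fun x => inner ℝ (MPoly.grad p x) e) with hG
  have hgc : Continuous (fun x => inner ℝ (MPoly.grad p x) e) :=
    (MPoly.continuous_grad p).inner continuous_const
  have hGm : Measurable G := hgc.measurable.indicator (measurableSet_hull K)
  have hGi : Integrable G (volume : Measure (Pt m)) :=
    (integrable_indicator_iff (measurableSet_hull K)).2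
      (hgc.continuousOn.integrableOn_compact (isCompact_hull K))
  have hsw : Measurable (fun q : ℝ × Pt m => q.2 + q.1 • e) := by fun_prop
  have hvol := volume_eq_map_sweep a' hge
  have hGi' : Integrable (fun q : ℝ × Pt m => G (q.2 + q.1 • e)) (volume.prod ν) := by
    rw [hvol, integrable_smul_measure (by simp) (htop _ hg0)] at hGi
    exact (integrable_map_measure hGm.aestronglyMeasurable hsw.aemeasurable).1 hGi
  have h1 : cellInt K (fun x => inner ℝ (MPoly.grad p x) e)
      = ‖b.grad a‖⁻¹ * ∫ y, (∫ t : ℝ, G (y + t • e)) ∂ν := by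
    rw [cellInt, ← integral_indicator (measurableSet_hull K), ← hG, hvol, integral_smul_measure,
      hfac, integral_map hsw.aemeasurable hGm.aestronglyMeasurable, integral_prod_symm _ hGi',
      smul_eq_mul]
  -- the integral along each line, by the fundamental theorem of calculus
  have hproj : ∀ y, projAlong (-b.grad a') a e y = y + b.lam a' y • e := by
    intro y
    rw [projAlong, inner_neg_left, b.inner_grad_sub, b.lam_ne ha' ha haa.symm]
    module
  have hH : ∀ y, y ∈ hyperplane (b.grad a) a' → b.lam a y = 0 := by
    intro y hy
    rw [hyperplane, Set.mem_ofPred_eq, b.inner_grad_sub, b.lam_ne ha ha' haa, sub_zero] at hy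
    exact hy
  set P' : Pt m → ℝ := (hull (opp K a')).indicator (MPoly.val p) with hP'
  set P : Pt m → ℝ := (hull (opp K a)).indicator (MPoly.val p) with hP
  have hline : ∀ y ∈ hyperplane (b.grad a) a',
      (∫ t : ℝ, G (y + t • e)) = P' (projAlong (-b.grad a') a e y) - P y := by
    intro y hy
    have hy0 := hH y hy
    have hpr : projAlong (-b.grad a') a e y ∈ hull (opp K a') ↔ y ∈ hull (opp K a) := by
      rw [hproj, b.mem_hull_opp ha', b.add_smul_edge_mem_hull ha ha' haa hy0, b.lam_add_smul, he,
        ← neg_sub a' a, inner_neg_right, b.inner_grad_edge_self ha' ha haa.symm]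
      constructor
      · exact fun h => h.1.1
      · intro h
        exact ⟨⟨h, b.mem_hull.1 (hull_opp_subset a h) a' ha', le_rfl⟩, by ring⟩
    by_cases hyF : y ∈ hull (opp K a)
    · have h0 : 0 ≤ b.lam a' y := b.mem_hull.1 (hull_opp_subset a hyF) a' ha'
      have hGt : (fun t : ℝ => G (y + t • e)) = (Set.Icc 0 (b.lam a' y)).indicator
          (fun t => inner ℝ (MPoly.grad p (y + t • e)) e) := by
        ext t
        rw [hG]
        by_cases ht : t ∈ Set.Icc 0 (b.lam a' y)
        · rw [Set.indicator_of_mem ht, Set.indicator_of_mem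
            ((b.add_smul_edge_mem_hull ha ha' haa hy0 t).2 ⟨hyF, ht⟩)]
        · rw [Set.indicator_of_notMem ht, Set.indicator_of_notMem
            (fun h => ht ((b.add_smul_edge_mem_hull ha ha' haa hy0 t).1 h).2)]
      have hcont : Continuous (fun t : ℝ => (inner ℝ (MPoly.grad p (y + t • e)) e : ℝ)) :=
        hgc.comp (by fun_prop)
      rw [hGt, integral_indicator measurableSet_Icc, integral_Icc_eq_integral_Ioc,
        ← intervalIntegral.integral_of_le h0,
        intervalIntegral.integral_eq_sub_of_hasDerivAt
          (fun t _ => MPoly.hasDerivAt_line p y e t) (hcont.intervalIntegrable _ _),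
        hP', hP, Set.indicator_of_mem (hpr.2 hyF), Set.indicator_of_mem hyF, hproj, zero_smul,
        add_zero]
    · have hGt : (fun t : ℝ => G (y + t • e)) = fun _ => 0 := by
        ext t
        rw [hG, Set.indicator_of_notMem
            (fun h => hyF ((b.add_smul_edge_mem_hull ha ha' haa hy0 t).1 h).1)]
      rw [hGt, integral_zero, hP', hP, Set.indicator_of_notMem (fun h => hyF (hpr.1 h)),
        Set.indicator_of_notMem hyF, sub_zero]
  have h2 : (∫ y, (∫ t : ℝ, G (y + t • e)) ∂ν)
      = ∫ y, (P' (projAlong (-b.grad a') a e y) - P y) ∂ν := by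
    refine integral_congr_ae ?_
    exact (ae_restrict_iff' (isClosed_hyperplane _ _).measurableSet).2
      (Filter.Eventually.of_forall hline)
  -- both terms as facet integrals
  have hsub : hull (opp K a) ⊆ hyperplane (b.grad a) a' := b.hull_opp_subset_hyperplane ha hmem
  have hsub' : hull (opp K a') ⊆ hyperplane (-b.grad a') a := by
    intro x hx
    have := b.hull_opp_subset_hyperplane ha' hmem' hx
    rw [hyperplane, Set.mem_ofPred_eq] at this ⊢
    rw [inner_neg_left, this, neg_zero]
  have hPi : Integrable P ν := by
    rw [hP, integrable_indicator_iff (measurableSet_hull _)]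
    exact (b.integrableOn_facet ha ⟨_, hmem⟩ hpc).mono_measure Measure.restrict_le_self
  have hPi' : Integrable P' ν' := by
    rw [hP', integrable_indicator_iff (measurableSet_hull _)]
    exact (b.integrableOn_facet ha' ⟨_, hmem'⟩ hpc).mono_measure Measure.restrict_le_self
  have hPint : ∫ y, P y ∂ν = surfInt (hull (opp K a)) (MPoly.val p) := by
    rw [hP, integral_indicator (measurableSet_hull _), hν,
      Measure.restrict_restrict (measurableSet_hull _), Set.inter_eq_left.2 hsub, surfInt]
  have hPint' : ∫ y, P' y ∂ν' = surfInt (hull (opp K a')) (MPoly.val p) := by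
    rw [hP', integral_indicator (measurableSet_hull _), hν',
      Measure.restrict_restrict (measurableSet_hull _), Set.inter_eq_left.2 hsub', surfInt]
  have hprm := (continuous_projAlong (-b.grad a') a e).measurable
  have hPm' : Measurable P' := hpc.measurable.indicator (measurableSet_hull _)
  have hmap := map_projAlong_restrict a' a hge hge'
  rw [← hν, ← hν'] at hmap
  have hcomp : Integrable (fun y => P' (projAlong (-b.grad a') a e y)) ν := by
    have h3 : Integrable P' (‖b.grad a‖ₑ⁻¹ • ν.map (projAlong (-b.grad a') a e)) := by
      rw [hmap]
      exact hPi'.smul_measure (htop _ (neg_ne_zero.2 hg0'))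
    rw [integrable_smul_measure (by simp) (htop _ hg0)] at h3
    exact (integrable_map_measure hPm'.aestronglyMeasurable hprm.aemeasurable).1 h3
  have hchange : ‖b.grad a‖⁻¹ * ∫ y, P' (projAlong (-b.grad a') a e y) ∂ν
      = ‖b.grad a'‖⁻¹ * ∫ y, P' y ∂ν' := by
    have h3 : ∫ y, P' y ∂(‖b.grad a‖ₑ⁻¹ • ν.map (projAlong (-b.grad a') a e))
        = ∫ y, P' y ∂(‖-b.grad a'‖ₑ⁻¹ • ν') := by rw [hmap]
    rwa [integral_smul_measure, integral_smul_measure, hfac, hfac, norm_neg, smul_eq_mul,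
      smul_eq_mul, integral_map hprm.aemeasurable hPm'.aestronglyMeasurable] at h3
  rw [h1, h2, integral_sub hcomp hPi, mul_sub, hchange, hPint, hPint']

/-- The divergence theorem on a simplex for the derivative of a polynomial in a fixed direction. -/
lemma cellInt_grad (b : BaryCoords K) (hcard : 2 ≤ K.card) (p : MPoly m) (e : Pt m) :
    cellInt K (fun x => inner ℝ (MPoly.grad p x) e)
      = ∑ v ∈ K, inner ℝ (outwardNormal K v) e * surfInt (hull (opp K v)) (MPoly.val p) := by
  classical
  have hne : ∀ v ∈ K, (opp K v).Nonempty := fun v hv => by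
    rw [← Finset.card_pos]; have := card_opp hv; omega
  obtain ⟨a', ha'⟩ : K.Nonempty := by rw [← Finset.card_pos]; omega
  set I : Pt m := ∫ x in hull K, MPoly.grad p x with hI
  have hint : IntegrableOn (MPoly.grad p) (hull K) :=
    (MPoly.continuous_grad p).continuousOn.integrableOn_compact (isCompact_hull K)
  have hL : ∀ e : Pt m, cellInt K (fun x => inner ℝ (MPoly.grad p x) e) = inner ℝ I e := by
    intro e
    rw [cellInt, hI, real_inner_comm, ← integral_inner hint]
    simp only [real_inner_comm]
  set J : Pt m := ∑ v ∈ K, surfInt (hull (opp K v)) (MPoly.val p) • outwardNormal K v with hJ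
  have hR : ∀ e : Pt m, ∑ v ∈ K, inner ℝ (outwardNormal K v) e * surfInt (hull (opp K v))
      (MPoly.val p) = inner ℝ J e := by
    intro e
    rw [hJ, sum_inner]
    exact Finset.sum_congr rfl fun v _ => by rw [real_inner_smul_left, mul_comm]
  rw [hL, hR]
  -- both sides are linear in `e` and agree on the edges, which span the space
  have hedge : ∀ a ∈ K, inner ℝ I (a - a') = inner ℝ J (a - a') := by
    intro a ha
    by_cases haa : a = a'
    · simp [haa]
    have hmem : a' ∈ opp K a := mem_opp.2 ⟨Ne.symm haa, ha'⟩
    have hmem' : a ∈ opp K a' := mem_opp.2 ⟨haa, ha⟩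
    have hna : inner ℝ (outwardNormal K a) (a - a') = -‖b.grad a‖⁻¹ := by
      rw [b.outwardNormal_eq ha ⟨_, hmem⟩, inner_neg_left, real_inner_smul_left,
        b.inner_grad_edge_self ha ha' haa, mul_one]
    have hna' : inner ℝ (outwardNormal K a') (a - a') = ‖b.grad a'‖⁻¹ := by
      rw [b.outwardNormal_eq ha' ⟨_, hmem'⟩, ← neg_sub a' a, inner_neg_neg, real_inner_smul_left,
        b.inner_grad_edge_self ha' ha (Ne.symm haa), mul_one]
    rw [← hL, b.cellInt_grad_edge ha ha' haa, ← hR, ← Finset.add_sum_erase K _ ha,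
      ← Finset.add_sum_erase (K.erase a) _ (Finset.mem_erase.2 ⟨Ne.symm haa, ha'⟩),
      Finset.sum_eq_zero (s := (K.erase a).erase a'), hna, hna']
    · ring
    · intro v hv
      simp only [Finset.mem_erase] at hv
      rw [b.outwardNormal_eq hv.2.2 (hne v hv.2.2), inner_neg_left, real_inner_smul_left,
        b.inner_grad_edge hv.2.2 ha ha' hv.2.1 hv.1]
      ring
  have he : e = ∑ v ∈ K, b.lam v (e + a') • (v - a') := by
    rw [b.sum_lam_smul_sub, add_sub_cancel_right]
  rw [he, inner_sum, inner_sum]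
  refine Finset.sum_congr rfl fun v hv => ?_
  rw [inner_smul_right, inner_smul_right, hedge v hv]

/-- **Divergence theorem** on a simplex, for polynomial vector fields. -/
lemma cellInt_vdiv (b : BaryCoords K) (hcard : 2 ≤ K.card) (u : Fin m → MPoly m) :
    cellInt K (vdiv u) = bdryInt K (fun _ n x => inner ℝ (vval u x) n) := by
  have hne : ∀ v ∈ K, (opp K v).Nonempty := fun v hv => by
    rw [← Finset.card_pos]; have := card_opp hv; omega
  have hdiv : vdiv u = fun x => ∑ i, inner ℝ (MPoly.grad (u i) x) (EuclideanSpace.single i 1) := by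
    ext x
    simp [vdiv, MPoly.inner_grad]
  have hint : ∀ i, IntegrableOn
      (fun x => (inner ℝ (MPoly.grad (u i) x) (EuclideanSpace.single i (1 : ℝ)) : ℝ)) (hull K) :=
    fun i => (((MPoly.continuous_grad (u i)).inner continuous_const).continuousOn).integrableOn_compact
      (isCompact_hull K)
  have h1 : cellInt K (vdiv u)
      = ∑ i, cellInt K fun x => inner ℝ (MPoly.grad (u i) x) (EuclideanSpace.single i 1) := by
    rw [hdiv, cellInt, integral_finsetSum _ fun i _ => hint i]
    rfl
  rw [h1, Finset.sum_congr rfl fun i _ => b.cellInt_grad hcard (u i) (EuclideanSpace.single i 1),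
    Finset.sum_comm, bdryInt]
  refine Finset.sum_congr rfl fun v hv => ?_
  have h2 : surfInt (hull (opp K v)) (fun x => inner ℝ (vval u x) (outwardNormal K v))
      = ∑ i, surfInt (hull (opp K v)) (fun x => MPoly.val (u i) x * outwardNormal K v i) := by
    simp only [inner_vval]
    unfold surfInt
    rw [integral_finsetSum]
    intro i _
    exact b.integrableOn_facet hv (hne v hv) ((MPoly.continuous_val (u i)).mul continuous_const)
  rw [h2]
  refine Finset.sum_congr rfl fun i _ => ?_
  unfold surfInt
  rw [integral_mul_const, mul_comm, EuclideanSpace.inner_single_right]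
  simp

end BaryCoords

/-! ### The discrete trace inequality -/

/-- A polynomial that vanishes near the origin is zero. -/
lemma MPoly.eq_zero_of_eqOn_ball {p : MPoly m} {r : ℝ} (hr : 0 < r)
    (h : ∀ x ∈ Metric.ball (0 : Pt m) r, MPoly.val p x = 0) : p = 0 := by
  have hopen : IsOpen {x : Fin m → ℝ | WithLp.toLp 2 x ∈ Metric.ball (0 : Pt m) r} :=
    Metric.isOpen_ball.preimage (PiLp.continuous_toLp 2 _)
  obtain ⟨ε, hε, hsub⟩ := Metric.isOpen_iff.1 hopen 0 (by simpa using hr)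
  refine MvPolynomial.funext_set (fun _ => Metric.ball (0 : ℝ) ε) (fun _ => ?_) fun x hx => ?_
  · rw [Real.ball_eq_Ioo]
    exact Set.Ioo_infinite (by linarith)
  · rw [← ball_pi _ hε] at hx
    have := h _ (hsub hx)
    simpa [MPoly.val] using this

/-- On polynomials of bounded degree, the maximum over the unit ball is controlled by the `L²` norm
over any ball about the origin. -/
lemma exists_sq_le_integral_ball (m k : ℕ) {r : ℝ} (hr : 0 < r) :
    ∃ C : ℝ, 0 ≤ C ∧ ∀ p ∈ Pk m k, ∀ y : Pt m, ‖y‖ ≤ 1 →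
      MPoly.val p y ^ 2 ≤ C * ∫ x in Metric.closedBall (0 : Pt m) r, MPoly.val p x ^ 2 := by
  set B := Metric.closedBall (0 : Pt m) r with hB
  have hcomp : IsCompact B := isCompact_closedBall _ _
  have : IsFiniteMeasure ((volume : Measure (Pt m)).restrict B) :=
    ⟨by rw [Measure.restrict_apply_univ]; exact hcomp.measure_lt_top⟩
  have hLp : ∀ p : MPoly m, MemLp (MPoly.val p) 2 ((volume : Measure (Pt m)).restrict B) := by
    intro p
    obtain ⟨c, hc⟩ := hcomp.exists_bound_of_continuousOn (MPoly.continuous_val p).continuousOn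
    refine MemLp.of_bound (MPoly.continuous_val p).aestronglyMeasurable c ?_
    exact (ae_restrict_iff' hcomp.measurableSet).2 (Filter.Eventually.of_forall hc)
  let J : Pk m k →ₗ[ℝ] Lp ℝ 2 ((volume : Measure (Pt m)).restrict B) :=
    { toFun := fun p => (hLp p).toLp (MPoly.val p)
      map_add' := fun p q => by
        rw [← MemLp.toLp_add]
        exact MemLp.toLp_congr _ _ (Filter.Eventually.of_forall fun x => by simp)
      map_smul' := fun c p => by
        rw [RingHom.id_apply, ← MemLp.toLp_const_smul]
        exact MemLp.toLp_congr _ _ (Filter.Eventually.of_forall fun x => by simp) }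
  let ev : Pk m k →ₗ[ℝ] C(Metric.closedBall (0 : Pt m) 1, ℝ) :=
    { toFun := fun p => ⟨fun y => MPoly.val (p : MPoly m) y,
        (MPoly.continuous_val (p : MPoly m)).comp continuous_subtype_val⟩
      map_add' := fun p q => by ext y; simp
      map_smul' := fun c p => by ext y; simp }
  have hJ : Function.Injective J := by
    rw [injective_iff_map_eq_zero]
    intro p hp
    have h1 : MPoly.val (p : MPoly m) =ᵐ[(volume : Measure (Pt m)).restrict B] 0 := by
      have h2 : ((J p : Lp ℝ 2 ((volume : Measure (Pt m)).restrict B)) : Pt m → ℝ)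
          =ᵐ[(volume : Measure (Pt m)).restrict B] MPoly.val (p : MPoly m) :=
        MemLp.coeFn_toLp (hLp p)
      rw [hp] at h2
      exact h2.symm.trans (Lp.coeFn_zero _ _ _)
    have h3 := Measure.eqOn_open_of_ae_eq
      (ae_restrict_of_ae_restrict_of_subset Metric.ball_subset_closedBall h1) Metric.isOpen_ball
      (MPoly.continuous_val (p : MPoly m)).continuousOn continuousOn_const
    exact Subtype.ext (MPoly.eq_zero_of_eqOn_ball hr fun x hx => h3 hx)
  let E : LinearMap.range J →L[ℝ] C(Metric.closedBall (0 : Pt m) 1, ℝ) :=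
    LinearMap.toContinuousLinearMap (ev ∘ₗ (LinearEquiv.ofInjective J hJ).symm.toLinearMap)
  refine ⟨‖E‖ ^ 2, by positivity, fun p hp y hy => ?_⟩
  set P : Pk m k := ⟨p, hp⟩
  have h1 : E (LinearEquiv.ofInjective J hJ P) = ev P := by
    simp [E]
  have h2 : ‖ev P‖ ≤ ‖E‖ * ‖J P‖ := by
    rw [← h1]
    exact E.le_opNorm _
  have h3 : |MPoly.val p y| ≤ ‖ev P‖ :=
    (ev P).norm_coe_le_norm ⟨y, by simpa using hy⟩
  have h4 : ‖J P‖ ^ 2 = ∫ x in B, MPoly.val p x ^ 2 := by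
    rw [← real_inner_self_eq_norm_sq, L2.inner_def]
    refine integral_congr_ae ?_
    have h5 : ((J P : Lp ℝ 2 ((volume : Measure (Pt m)).restrict B)) : Pt m → ℝ)
        =ᵐ[(volume : Measure (Pt m)).restrict B] MPoly.val p := MemLp.coeFn_toLp (hLp p)
    filter_upwards [h5] with x hx
    rw [hx]
    simp [pow_two]
  calc MPoly.val p y ^ 2 = |MPoly.val p y| ^ 2 := (sq_abs _).symm
    _ ≤ (‖E‖ * ‖J P‖) ^ 2 := by
        have := h3.trans h2
        gcongr
    _ = ‖E‖ ^ 2 * ∫ x in B, MPoly.val p x ^ 2 := by rw [mul_pow, h4]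

/-- The scaled form of the previous estimate: the maximum over the ball of radius `h` is controlled
by the mean square over a concentric ball of comparable size. -/
lemma exists_sq_le_integral_ball_scaled (m k : ℕ) {r : ℝ} (hr : 0 < r) :
    ∃ C : ℝ, 0 ≤ C ∧ ∀ p ∈ Pk m k, ∀ (z : Pt m) (h : ℝ), 0 < h → ∀ x : Pt m, dist x z ≤ h →
      MPoly.val p x ^ 2
        ≤ C * (h ^ m)⁻¹ * ∫ y in Metric.closedBall z (h * r), MPoly.val p y ^ 2 := by
  obtain ⟨C, hC, hbound⟩ := exists_sq_le_integral_ball m k hr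
  refine ⟨C, hC, fun p hp z h hh x hx => ?_⟩
  obtain ⟨q, hq, hqp⟩ := MPoly.exists_rescale hp z h
  have h1 := hbound q hq (h⁻¹ • (x - z)) (by
    rw [norm_smul, norm_inv, Real.norm_of_nonneg hh.le, ← dist_eq_norm]
    rw [inv_mul_le_iff₀ hh, mul_one]
    exact hx)
  rw [hqp, smul_smul, mul_inv_cancel₀ hh.ne', one_smul, add_sub_cancel] at h1
  have h2 : ∫ y in Metric.closedBall (0 : Pt m) r, MPoly.val q y ^ 2
      = (h ^ m)⁻¹ * ∫ y in Metric.closedBall z (h * r), MPoly.val p y ^ 2 := by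
    set f : Pt m → ℝ := (Metric.closedBall z (h * r)).indicator (fun y => MPoly.val p y ^ 2)
      with hf
    have h3 : (Metric.closedBall (0 : Pt m) r).indicator (fun y => MPoly.val q y ^ 2)
        = fun y => f (z + h • y) := by
      ext y
      have hiff : z + h • y ∈ Metric.closedBall z (h * r) ↔ y ∈ Metric.closedBall (0 : Pt m) r := by
        rw [Metric.mem_closedBall, Metric.mem_closedBall, dist_eq_norm, dist_zero_right,
          add_sub_cancel_left, norm_smul, Real.norm_of_nonneg hh.le]
        exact mul_le_mul_iff_right₀ hh
      by_cases hy : y ∈ Metric.closedBall (0 : Pt m) r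
      · rw [Set.indicator_of_mem hy, hf, Set.indicator_of_mem (hiff.2 hy), hqp]
      · rw [Set.indicator_of_notMem hy, hf, Set.indicator_of_notMem (fun h => hy (hiff.1 h))]
    rw [← integral_indicator Metric.isClosed_closedBall.measurableSet, h3,
      Measure.integral_comp_smul volume (fun y => f (z + y)) h, integral_add_left_eq_self f z,
      hf, integral_indicator Metric.isClosed_closedBall.measurableSet, finrank_euclideanSpace_fin,
      abs_of_pos (by positivity), smul_eq_mul]
  rw [h2] at h1
  rw [mul_assoc]
  exact h1

/-- The vector field `x ↦ x - z`. -/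
def radialField (z : Pt m) : Fin m → MPoly m := fun i => MvPolynomial.X i - MvPolynomial.C (z i)

lemma vval_radialField (z x : Pt m) : vval (radialField z) x = x - z := by
  ext i
  simp [vval, radialField]

lemma vdiv_radialField (z x : Pt m) : vdiv (radialField z) x = m := by
  simp [vdiv, radialField, MvPolynomial.pderiv_X, MPoly.val]

lemma IsSimplex.opp_nonempty {K : Finset (Pt m)} (hK : IsSimplex K) (hm : 0 < m) {v : Pt m}
    (hv : v ∈ K) : (opp K v).Nonempty := by
  rw [← Finset.card_pos]
  have h1 := BaryCoords.card_opp hv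
  have h2 := hK.card
  omega

lemma IsSimplex.diamK_pos {K : Finset (Pt m)} (hK : IsSimplex K) (hm : 0 < m) : 0 < diamK K := by
  have hcard := hK.card
  obtain ⟨a, ha, c, hc, hac⟩ := Finset.one_lt_card.1 (show 1 < K.card by omega)
  have h1 : dist a c ≤ diamK K := Metric.dist_le_diam_of_mem (isCompact_hull K).isBounded
    (subset_convexHull ℝ _ ha) (subset_convexHull ℝ _ hc)
  exact (dist_pos.2 hac).trans_le h1

/-- The facets of a simplex see the center of an inscribed ball of radius `r` at height at least
`r`. -/
lemma BaryCoords.le_inner_outwardNormal {K : Finset (Pt m)} (b : BaryCoords K) {v : Pt m}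
    (hv : v ∈ K) (hne : (opp K v).Nonempty) {z : Pt m} {r : ℝ} (hr : 0 ≤ r)
    (hz : Metric.closedBall z r ⊆ hull K) {x : Pt m} (hx : x ∈ hull (opp K v)) :
    r ≤ inner ℝ (x - z) (outwardNormal K v) := by
  obtain ⟨w, hw⟩ := id hne
  have hg : 0 < ‖b.grad v‖ := norm_pos_iff.2 (b.grad_ne_zero hv hw)
  have hmem : z + (-r) • (‖b.grad v‖⁻¹ • b.grad v) ∈ hull K := by
    apply hz
    rw [Metric.mem_closedBall, dist_eq_norm, add_sub_cancel_left, norm_smul, norm_smul, norm_inv,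
      norm_norm, inv_mul_cancel₀ hg.ne', norm_neg, Real.norm_of_nonneg hr, mul_one]
  have h1 := b.mem_hull.1 hmem v hv
  rw [b.lam_add_smul, inner_smul_right, real_inner_self_eq_norm_sq] at h1
  have h2 : ‖b.grad v‖⁻¹ * ‖b.grad v‖ ^ 2 = ‖b.grad v‖ := by field_simp
  rw [h2] at h1
  rw [b.outwardNormal_eq hv hne, inner_neg_right, inner_smul_right, real_inner_comm,
    b.inner_grad_sub, ((b.mem_hull_opp hv).1 hx).2]
  have h3 : -(‖b.grad v‖⁻¹ * (0 - b.lam v z)) = b.lam v z / ‖b.grad v‖ := by ring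
  rw [h3, le_div_iff₀ hg]
  linarith

/-- The surface area of a simplex that contains a ball of radius `r` about `z`, bounded through the
divergence of the field `x - z`. -/
lemma IsSimplex.area_le {K : Finset (Pt m)} (hK : IsSimplex K) (hm : 0 < m) {z : Pt m} {r : ℝ}
    (hr : 0 < r) (hz : Metric.closedBall z r ⊆ hull K) :
    r * bdryInt K (fun _ _ _ => 1)
      ≤ m * (diamK K ^ m * (volume (Metric.ball (0 : Pt m) 1)).toReal) := by
  obtain ⟨b⟩ := hK.nonempty_baryCoords
  have hcard := hK.card
  have hdiv := b.cellInt_vdiv (by omega) (radialField z)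
  have h1 : r * bdryInt K (fun _ _ _ => 1) ≤ cellInt K (vdiv (radialField z)) := by
    rw [hdiv, bdryInt, bdryInt, Finset.mul_sum]
    refine Finset.sum_le_sum fun v hv => ?_
    have hne := hK.opp_nonempty hm hv
    rw [surfInt, surfInt, ← integral_const_mul]
    refine setIntegral_mono_on (b.integrableOn_facet hv hne (by fun_prop))
      (b.integrableOn_facet hv hne ((continuous_vval _).inner continuous_const))
      (measurableSet_hull _) fun x hx => ?_
    rw [mul_one, vval_radialField]
    exact b.le_inner_outwardNormal hv hne hr.le hz hx
  refine h1.trans ?_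
  have hzK : z ∈ hull K := hz (Metric.mem_closedBall_self hr.le)
  have hsub : hull K ⊆ Metric.closedBall z (diamK K) := fun x hx =>
    Metric.dist_le_diam_of_mem (isCompact_hull K).isBounded hx hzK
  have h2 : cellInt K (vdiv (radialField z)) = m * (volume (hull K)).toReal := by
    rw [cellInt]
    simp only [vdiv_radialField]
    rw [setIntegral_const, smul_eq_mul, mul_comm]
    rfl
  rw [h2]
  refine mul_le_mul_of_nonneg_left ?_ (Nat.cast_nonneg m)
  have hd : 0 ≤ diamK K := Metric.diam_nonneg
  have h3 : (volume (Metric.closedBall z (diamK K))).toReal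
      = diamK K ^ m * (volume (Metric.ball (0 : Pt m) 1)).toReal := by
    rw [Measure.addHaar_closedBall volume z hd, finrank_euclideanSpace_fin,
      ENNReal.toReal_mul, ENNReal.toReal_ofReal (by positivity)]
  rw [← h3]
  exact ENNReal.toReal_mono (isCompact_closedBall _ _).measure_lt_top.ne (measure_mono hsub)

/-- **Discrete trace inequality** on shape regular simplices. -/
lemma exists_trace_inequality {m : ℕ} (hm : 0 < m) (k : ℕ) {σ : ℝ} (hσ : 0 < σ) :
    ∃ C : ℝ, 0 ≤ C ∧ ∀ (K : Finset (Pt m)), IsSimplex K →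
      (∃ z : Pt m, Metric.closedBall z (diamK K / (2 * σ)) ⊆ hull K) → ∀ p ∈ Pk m k,
      bdryInt K (fun _ _ x => MPoly.val p x ^ 2)
        ≤ C * (diamK K)⁻¹ * cellInt K (fun x => MPoly.val p x ^ 2) := by
  obtain ⟨C, hC, hbound⟩ := exists_sq_le_integral_ball_scaled m k
    (show (0 : ℝ) < 1 / (2 * σ) by positivity)
  set ω := (volume (Metric.ball (0 : Pt m) 1)).toReal with hω
  have hω0 : 0 ≤ ω := ENNReal.toReal_nonneg
  refine ⟨C * (2 * σ * (m * ω)), by positivity, ?_⟩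
  rintro K hK ⟨z, hz⟩ p hp
  obtain ⟨b⟩ := hK.nonempty_baryCoords
  set h := diamK K with hh
  have hpos : 0 < h := hK.diamK_pos hm
  have hr : 0 < h / (2 * σ) := by positivity
  set I := cellInt K (fun x => MPoly.val p x ^ 2) with hI
  have hpc : Continuous (fun x => MPoly.val p x ^ 2) := (MPoly.continuous_val p).pow 2
  have hI0 : 0 ≤ I := integral_nonneg fun x => sq_nonneg _
  have hzK : z ∈ hull K := hz (Metric.mem_closedBall_self hr.le)
  have hsup : ∀ x ∈ hull K, MPoly.val p x ^ 2 ≤ C * (h ^ m)⁻¹ * I := by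
    intro x hx
    refine (hbound p hp z h hpos x
      (Metric.dist_le_diam_of_mem (isCompact_hull K).isBounded hx hzK)).trans ?_
    refine mul_le_mul_of_nonneg_left ?_ (by positivity)
    rw [mul_one_div]
    exact setIntegral_mono_set (hpc.continuousOn.integrableOn_compact (isCompact_hull K))
      (Filter.Eventually.of_forall fun x => sq_nonneg _) hz.eventuallyLE
  have harea := hK.area_le hm hr hz
  have h1 : bdryInt K (fun _ _ x => MPoly.val p x ^ 2)
      ≤ C * (h ^ m)⁻¹ * I * bdryInt K (fun _ _ _ => 1) := by
    rw [bdryInt, bdryInt, Finset.mul_sum]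
    refine Finset.sum_le_sum fun v hv => ?_
    have hne := hK.opp_nonempty hm hv
    rw [surfInt, surfInt, ← integral_const_mul]
    refine setIntegral_mono_on (b.integrableOn_facet hv hne hpc)
      (b.integrableOn_facet hv hne (by fun_prop)) (measurableSet_hull _) fun x hx => ?_
    rw [mul_one]
    exact hsup x (BaryCoords.hull_opp_subset v hx)
  have h2 : bdryInt K (fun _ _ _ => 1) ≤ 2 * σ * (m * ω) * h ^ m * h⁻¹ := by
    rw [← mul_le_mul_iff_right₀ hr]
    refine harea.trans (le_of_eq ?_)
    rw [← hh, ← hω]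
    field_simp
  refine h1.trans ((mul_le_mul_of_nonneg_left h2 (by positivity)).trans (le_of_eq ?_))
  field_simp

/-! ### Boundary integrals -/

namespace IsSimplex

variable {K : Finset (Pt m)}

lemma integrableOn_facet (hK : IsSimplex K) (hm : 0 < m) {v : Pt m} (hv : v ∈ K) {f : Pt m → ℝ}
    (hf : Continuous f) : IntegrableOn f (hull (opp K v)) (μHE[m - 1] : Measure (Pt m)) := by
  obtain ⟨b⟩ := hK.nonempty_baryCoords
  exact b.integrableOn_facet hv (hK.opp_nonempty hm hv) hf

lemma surface_facet_lt_top (hK : IsSimplex K) (hm : 0 < m) {v : Pt m} (hv : v ∈ K) :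
    (μHE[m - 1] : Measure (Pt m)) (hull (opp K v)) < ⊤ := by
  obtain ⟨b⟩ := hK.nonempty_baryCoords
  exact b.surface_facet_lt_top hv (hK.opp_nonempty hm hv)

lemma norm_outwardNormal (hK : IsSimplex K) (hm : 0 < m) {v : Pt m} (hv : v ∈ K) :
    ‖outwardNormal K v‖ = 1 := by
  obtain ⟨b⟩ := hK.nonempty_baryCoords
  exact b.norm_outwardNormal hv (hK.opp_nonempty hm hv)

lemma bdryInt_add (hK : IsSimplex K) (hm : 0 < m) {f g : Finset (Pt m) → Pt m → Pt m → ℝ}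
    (hf : ∀ F n, Continuous (f F n)) (hg : ∀ F n, Continuous (g F n)) :
    bdryInt K (fun F n x => f F n x + g F n x) = bdryInt K f + bdryInt K g := by
  rw [bdryInt, bdryInt, bdryInt, ← Finset.sum_add_distrib]
  exact Finset.sum_congr rfl fun v hv =>
    integral_add (hK.integrableOn_facet hm hv (hf _ _)) (hK.integrableOn_facet hm hv (hg _ _))

lemma bdryInt_sub (hK : IsSimplex K) (hm : 0 < m) {f g : Finset (Pt m) → Pt m → Pt m → ℝ}
    (hf : ∀ F n, Continuous (f F n)) (hg : ∀ F n, Continuous (g F n)) :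
    bdryInt K (fun F n x => f F n x - g F n x) = bdryInt K f - bdryInt K g := by
  rw [bdryInt, bdryInt, bdryInt, ← Finset.sum_sub_distrib]
  exact Finset.sum_congr rfl fun v hv =>
    integral_sub (hK.integrableOn_facet hm hv (hf _ _)) (hK.integrableOn_facet hm hv (hg _ _))

lemma volume_facet (hK : IsSimplex K) (hm : 0 < m) {v : Pt m} (hv : v ∈ K) :
    volume (hull (opp K v)) = 0 := by
  have h := Measure.euclideanHausdorffMeasure_zero_or_top (X := Pt m)
    (show m - 1 < m by omega) (hull (opp K v))
  rw [EuclideanSpace.euclideanHausdorffMeasure_eq_volume] at h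
  exact h.resolve_right (hK.surface_facet_lt_top hm hv).ne

end IsSimplex

lemma bdryInt_const_mul (K : Finset (Pt m)) (c : ℝ) (f : Finset (Pt m) → Pt m → Pt m → ℝ) :
    bdryInt K (fun F n x => c * f F n x) = c * bdryInt K f := by
  rw [bdryInt, bdryInt, Finset.mul_sum]
  exact Finset.sum_congr rfl fun v _ => integral_const_mul _ _

open scoped Classical in
/-- The pairs of an element of `S` and a vertex of it whose opposite facet is `F`. -/
def sides (S : Finset (Finset (Pt m))) (F : Finset (Pt m)) :
    Finset ((_ : Finset (Pt m)) × Pt m) :=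
  (S.sigma fun K => K).filter fun i => opp i.1 i.2 = F

lemma mem_sides {S : Finset (Finset (Pt m))} {F : Finset (Pt m)}
    {i : (_ : Finset (Pt m)) × Pt m} :
    i ∈ sides S F ↔ i.1 ∈ S ∧ i.2 ∈ i.1 ∧ opp i.1 i.2 = F := by
  simp [sides, and_assoc]

lemma mem_facetsOf {S : Finset (Finset (Pt m))} {F : Finset (Pt m)} :
    F ∈ facetsOf S ↔ ∃ K ∈ S, ∃ v ∈ K, opp K v = F := by
  simp [facetsOf]

/-- Boundary integrals summed over elements, rearranged by facets. -/
lemma sum_bdryInt_eq_sum_facets (S : Finset (Finset (Pt m)))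
    (f : Finset (Pt m) → Finset (Pt m) → Pt m → Pt m → ℝ) :
    ∑ K ∈ S, bdryInt K (f K)
      = ∑ F ∈ facetsOf S, ∑ i ∈ sides S F,
          surfInt (hull F) (f i.1 F (outwardNormal i.1 i.2)) := by
  classical
  simp only [bdryInt]
  rw [Finset.sum_sigma', ← Finset.sum_fiberwise_of_maps_to (t := facetsOf S)
    (g := fun i : (_ : Finset (Pt m)) × Pt m => opp i.1 i.2)]
  · refine Finset.sum_congr rfl fun F _ => ?_
    unfold sides
    refine Finset.sum_congr (by congr) fun i hi => ?_
    rw [(Finset.mem_filter.1 hi).2]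
  · intro i hi
    rw [Finset.mem_sigma] at hi
    exact mem_facetsOf.2 ⟨i.1, hi.1, i.2, hi.2, rfl⟩

/-! ### Geometry of the mesh -/

namespace Mesh

variable (T : Mesh m)

lemma mem_elements {K : Finset (Pt m)} : K ∈ T.elements ↔ K ∈ T.stokes ∨ K ∈ T.darcy := by
  simp [elements]

lemma mem_faces {K : Finset (Pt m)} (hK : K ∈ T.elements) : K ∈ T.complex.faces :=
  ((T.elements_iff K).1 (T.mem_elements.1 hK)).1

lemma isSimplex {K : Finset (Pt m)} (hK : K ∈ T.elements) : IsSimplex K :=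
  ⟨T.complex.indep (T.mem_faces hK), ((T.elements_iff K).1 (T.mem_elements.1 hK)).2⟩

lemma sum_elements (f : Finset (Pt m) → ℝ) :
    ∑ K ∈ T.elements, f K = ∑ K ∈ T.stokes, f K + ∑ K ∈ T.darcy, f K := by
  classical
  rw [← Finset.sum_union (Finset.disjoint_left.2 T.disj)]
  unfold elements
  congr

lemma exists_vertex_notMem {K K' : Finset (Pt m)} (hK : K ∈ T.elements)
    (hK' : K' ∈ T.elements) (hne : K ≠ K') : ∃ v ∈ K, v ∉ K' := by
  by_contra! h
  exact hne (Finset.eq_of_subset_of_card_le h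
    (by rw [(T.isSimplex hK).card, (T.isSimplex hK').card]))

/-- Two elements meet within any facet opposite to a vertex that they do not share. -/
lemma inter_subset_hull_opp {K K' : Finset (Pt m)} (hK : K ∈ T.elements)
    (hK' : K' ∈ T.elements) {v : Pt m} (hvK' : v ∉ K') :
    hull K ∩ hull K' ⊆ hull (opp K v) := by
  refine (T.complex.inter_subset_convexHull (T.mem_faces hK) (T.mem_faces hK')).trans
    (convexHull_mono ?_)
  rintro x ⟨hx, hx'⟩
  exact BaryCoords.mem_opp.2 ⟨fun h => hvK' (h ▸ hx'), hx⟩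

lemma volume_inter_eq_zero (hm : 0 < m) {K K' : Finset (Pt m)} (hK : K ∈ T.elements)
    (hK' : K' ∈ T.elements) (hne : K ≠ K') : volume (hull K ∩ hull K') = 0 := by
  obtain ⟨v, hv, hvK'⟩ := T.exists_vertex_notMem hK hK' hne
  exact measure_mono_null (T.inter_subset_hull_opp hK hK' hvK')
    ((T.isSimplex hK).volume_facet hm hv)

/-- Two elements with a common facet lie on opposite sides of it. -/
lemma outwardNormal_eq_neg (hm : 0 < m) {K K' : Finset (Pt m)} (hK : K ∈ T.elements)
    (hK' : K' ∈ T.elements) (hne : K ≠ K') {v v' : Pt m} (hv : v ∈ K) (hv' : v' ∈ K')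
    (hopp : opp K v = opp K' v') : outwardNormal K' v' = -outwardNormal K v := by
  have hFne := (T.isSimplex hK).opp_nonempty hm hv
  have hFne' := (T.isSimplex hK').opp_nonempty hm hv'
  obtain ⟨b⟩ := (T.isSimplex hK).nonempty_baryCoords
  obtain ⟨b'⟩ := (T.isSimplex hK').nonempty_baryCoords
  have hvK' : v ∉ K' := by
    intro h
    refine hne (Finset.eq_of_subset_of_card_le (fun w hw => ?_)
      (by rw [(T.isSimplex hK).card, (T.isSimplex hK').card]))
    by_cases hwv : w = v
    · exact hwv ▸ h
    · exact BaryCoords.opp_subset v' (hopp ▸ BaryCoords.mem_opp.2 ⟨hwv, hw⟩)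
  obtain ⟨w₀, hw₀⟩ := id hFne
  have hw₀' : w₀ ∈ opp K' v' := hopp ▸ hw₀
  -- the gradients of the two coordinates that vanish on the facet are parallel
  obtain ⟨c, hc⟩ : ∃ c : ℝ, c • b.grad v = b'.grad v' := by
    rw [← Submodule.mem_span_singleton, ← b.orthogonal_vectorSpan_opp hv hFne, hopp,
      b'.orthogonal_vectorSpan_opp hv' hFne']
    exact Submodule.mem_span_singleton_self _
  have hlam0 : ∀ x ∈ hull (opp K v), b.lam v x = 0 := fun x hx => ((b.mem_hull_opp hv).1 hx).2
  have hw₀lam : b.lam v w₀ = 0 := hlam0 w₀ (subset_convexHull ℝ _ hw₀)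
  have hc1 : c * b.lam v v' = 1 := by
    have h1 := b'.inner_grad_sub v' v' w₀
    rw [b'.lam_self hv', b'.lam_ne hv' (BaryCoords.mem_opp.1 hw₀').2
      (BaryCoords.mem_opp.1 hw₀').1.symm, ← hc, real_inner_smul_left, b.inner_grad_sub, hw₀lam]
      at h1
    linarith
  -- if `v'` were on the side of `v`, the elements would overlap near the center of the facet
  have hneg : b.lam v v' ≤ 0 := by
    by_contra! hpos
    set x : Pt m := ∑ w ∈ opp K v, ((opp K v).card : ℝ)⁻¹ • w with hx
    have hcard : (0 : ℝ) < (opp K v).card := by exact_mod_cast hFne.card_pos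
    have hsum : ∑ w ∈ opp K v, ((opp K v).card : ℝ)⁻¹ = 1 := by
      rw [Finset.sum_const, nsmul_eq_mul, mul_inv_cancel₀ hcard.ne']
    have hxF : x ∈ hull (opp K v) :=
      (convex_convexHull ℝ _).sum_mem (fun w _ => by positivity) hsum
        fun w hw => subset_convexHull ℝ _ hw
    have hxlam : ∀ w ∈ opp K v, 0 < b.lam w x := by
      intro w hw
      have hwK := (BaryCoords.mem_opp.1 hw).2
      have h1 : b.lam w x = ∑ y ∈ opp K v, ((opp K v).card : ℝ)⁻¹ * b.lam w y := by
        simp only [BaryCoords.lam, hx, inner_sum, inner_smul_right, mul_add,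
          Finset.sum_add_distrib, ← Finset.sum_mul, hsum, one_mul]
      rw [h1]
      refine Finset.sum_pos' (fun y hy => ?_) ⟨w, hw, ?_⟩
      · refine mul_nonneg (by positivity) ?_
        exact b.mem_hull.1 (subset_convexHull ℝ _ (BaryCoords.mem_opp.1 hy).2) w hwK
      · rw [b.lam_self hwK]
        positivity
    have hev : ∀ᶠ ε in nhdsWithin (0 : ℝ) (Set.Ioi 0),
        ∀ w ∈ opp K v, 0 < b.lam w (x + ε • (v' - x)) := by
      rw [Filter.eventually_all_finset]
      intro w hw
      have hcont : Continuous (fun ε : ℝ => b.lam w (x + ε • (v' - x))) := by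
        unfold BaryCoords.lam; fun_prop
      refine nhdsWithin_le_nhds (hcont.continuousAt.eventually (lt_mem_nhds ?_))
      simpa using hxlam w hw
    have hIoo : ∀ᶠ ε in nhdsWithin (0 : ℝ) (Set.Ioi 0), ε ∈ Set.Ioo (0 : ℝ) 1 :=
      Ioo_mem_nhdsGT one_pos
    obtain ⟨ε, hε, hε0, hε1⟩ := (hev.and hIoo).exists
    set y := x + ε • (v' - x) with hy
    have hlamy : b.lam v y = ε * b.lam v v' := by
      rw [hy, b.lam_add_smul, b.inner_grad_sub, hlam0 x hxF]; ring
    have hyK : y ∈ hull K := by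
      rw [b.mem_hull]
      intro w hw
      by_cases hwv : w = v
      · rw [hwv, hlamy]; positivity
      · exact (hε w (BaryCoords.mem_opp.2 ⟨hwv, hw⟩)).le
    have hyK' : y ∈ hull K' := by
      have hxK' : x ∈ hull K' := BaryCoords.hull_opp_subset v' (hopp ▸ hxF)
      have hv'K' : v' ∈ hull K' := subset_convexHull ℝ _ hv'
      exact (convex_convexHull ℝ _).add_smul_sub_mem hxK' hv'K' ⟨hε0.le, hε1.le⟩
    have h0 := hlam0 y (T.inter_subset_hull_opp hK hK' hvK' ⟨hyK, hyK'⟩)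
    rw [hlamy] at h0
    exact (mul_pos hε0 hpos).ne' h0
  have hc0 : c < 0 := by
    by_contra! h
    have := mul_nonpos_of_nonneg_of_nonpos h hneg
    linarith
  have hg : ‖b.grad v‖ ≠ 0 := norm_ne_zero_iff.2 (b.grad_ne_zero hv hw₀)
  rw [b.outwardNormal_eq hv hFne, b'.outwardNormal_eq hv' hFne', ← hc, norm_smul, smul_smul,
    Real.norm_of_nonpos hc0.le, neg_neg, ← neg_smul]
  congr 1
  have := hc0.ne
  field_simp

/-- At an interface facet the outward normals of the adjacent elements cancel. -/
lemma sum_outwardNormal_interface (hm : 0 < m) {F : Finset (Pt m)} (hF : F ∈ T.interface) :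
    ∑ i ∈ sides T.elements F, outwardNormal i.1 i.2 = 0 := by
  classical
  rw [interface, Finset.mem_inter] at hF
  obtain ⟨K, hKs, v, hv, hKF⟩ := mem_facetsOf.1 hF.1
  obtain ⟨K', hKd, v', hv', hKF'⟩ := mem_facetsOf.1 hF.2
  have hK : K ∈ T.elements := T.mem_elements.2 (Or.inl hKs)
  have hK' : K' ∈ T.elements := T.mem_elements.2 (Or.inr hKd)
  have hne : K ≠ K' := fun h => T.disj K hKs (h ▸ hKd)
  have hnn := T.outwardNormal_eq_neg hm hK hK' hne hv hv' (hKF.trans hKF'.symm)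
  have hvert : ∀ (L : Finset (Pt m)) (a c : Pt m), a ∈ L → opp L a = opp L c → a = c := by
    intro L a c ha h
    by_contra hac
    have h1 : a ∈ opp L c := BaryCoords.mem_opp.2 ⟨hac, ha⟩
    rw [← h] at h1
    exact (BaryCoords.mem_opp.1 h1).1 rfl
  have hsides : sides T.elements F = {⟨K, v⟩, ⟨K', v'⟩} := by
    ext ⟨L, a⟩
    rw [mem_sides, Finset.mem_insert, Finset.mem_singleton]
    constructor
    · rintro ⟨hL, ha, hLF⟩
      simp only at hL ha hLF
      by_cases hLK : L = K
      · subst hLK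
        exact Or.inl (by rw [hvert L a v ha (hLF.trans hKF.symm)])
      by_cases hLK' : L = K'
      · subst hLK'
        exact Or.inr (by rw [hvert L a v' ha (hLF.trans hKF'.symm)])
      -- a third element would have to lie on both sides of the facet
      exfalso
      have h1 := T.outwardNormal_eq_neg hm hK hL (Ne.symm hLK) hv ha (hKF.trans hLF.symm)
      have h2 := T.outwardNormal_eq_neg hm hK' hL (Ne.symm hLK') hv' ha (hKF'.trans hLF.symm)
      rw [hnn, neg_neg, h1] at h2
      have h3 := (T.isSimplex hK).norm_outwardNormal hm hv
      have h4 : (2 : ℝ) • outwardNormal K v = 0 := by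
        rw [two_smul]
        nth_rewrite 1 [← h2]
        exact neg_add_cancel _
      rw [(smul_eq_zero.1 h4).resolve_left two_ne_zero, norm_zero] at h3
      exact zero_ne_one h3
    · rintro (h | h) <;> cases h
      · exact ⟨hK, hv, hKF⟩
      · exact ⟨hK', hv', hKF'⟩
  rw [hsides, Finset.sum_pair (fun h => hne (congrArg Sigma.fst h)), hnn, add_neg_cancel]

end Mesh

/-! ### Mass conservation of the discrete velocity -/

@[simp] lemma vval_zero (x : Pt m) : vval (fun _ => (0 : MPoly m)) x = 0 := by
  ext i; simp [vval]

@[simp] lemma strain_zero (x : Pt m) : strain (fun _ => (0 : MPoly m)) x = 0 := by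
  ext i j; simp [strain]

@[simp] lemma mulE_zero_left (x : Pt m) : mulE 0 x = 0 := by
  ext i; simp [mulE]

@[simp] lemma frobInner_zero_right (A : Matrix (Fin m) (Fin m) ℝ) : frobInner A 0 = 0 := by
  simp [frobInner]

@[simp] lemma cellInt_zero (K : Finset (Pt m)) : cellInt K (fun _ => 0) = 0 := by
  simp [cellInt]

@[simp] lemma surfInt_zero (A : Set (Pt m)) : surfInt A (fun _ => 0) = 0 := by
  simp [surfInt]

@[simp] lemma bdryInt_zero (K : Finset (Pt m)) : bdryInt K (fun _ _ _ => 0) = 0 := by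
  simp [bdryInt]

/-- Testing the discrete flow problem with pressures only. -/
lemma SolvesFlow.formBTotal_eq {T : Mesh m} {k : ℕ} {Ωs Ωd : Set (Pt m)} {P : FlowData m Ωs Ωd}
    {τ : Finset (Pt m) → Fin (m - 1) → Pt m} {β dt : ℝ}
    {u0 : Finset (Pt m) → Fin m → MPoly m} {c0 : Scalar m} {gi gp : Pt m → ℝ}
    {u : Velocity m} {p : Pressure m} (h : SolvesFlow T k P τ β dt u0 c0 gi gp u p)
    {q : Pressure m} (hq : MemQ T k q) :
    formBTotal T q u
      = ∑ K ∈ T.darcy, cellInt K fun x => (gp x - gi x) * (q.cell K).val x := by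
  have hv : MemV T (k + 1) (⟨fun _ _ => 0, fun _ _ => 0⟩ : Velocity m) :=
    ⟨fun K _ i => Submodule.zero_mem _, fun F _ i => Submodule.zero_mem _,
      fun F _ _ x _ => vval_zero x⟩
  have h1 := h.2.2 ⟨fun _ _ => 0, fun _ _ => 0⟩ q hv hq
  have hdiv : ∀ x : Pt m, vdiv (fun _ => (0 : MPoly m)) x = 0 := fun x => by simp [vdiv]
  simpa [formBsd, formAS, formAD, formAI, formBTotal, formB, formBI, hdiv] using h1

open scoped Classical in
/-- The element velocity on `K`, less the facet velocity if `F` is an interface facet. -/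
def jumpPoly (T : Mesh m) (u : Velocity m) (K F : Finset (Pt m)) : Fin m → MPoly m :=
  fun j => u.cell K j - if F ∈ T.interface then u.facet F j else 0

lemma vval_jumpPoly_of_mem {T : Mesh m} (u : Velocity m) (K : Finset (Pt m)) {F : Finset (Pt m)}
    (hF : F ∈ T.interface) (x : Pt m) :
    vval (jumpPoly T u K F) x = vval (u.cell K) x - vval (u.facet F) x := by
  ext i; simp [vval, jumpPoly, hF]

lemma vval_jumpPoly_of_notMem {T : Mesh m} (u : Velocity m) (K : Finset (Pt m))
    {F : Finset (Pt m)} (hF : F ∉ T.interface) (x : Pt m) :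
    vval (jumpPoly T u K F) x = vval (u.cell K) x := by
  ext i; simp [vval, jumpPoly, hF]

/-- The facet terms of the pressure form test the normal fluxes of `jumpPoly`. -/
lemma formB_add_formBI (hm : 0 < m) (T : Mesh m) {S : Finset (Finset (Pt m))}
    (hS : ∀ K ∈ S, K ∈ T.elements) (q qbar : Finset (Pt m) → MPoly m) (u : Velocity m) :
    formB S q qbar u + formBI T S qbar u
      = -(∑ K ∈ S, cellInt K fun x => (q K).val x * vdiv (u.cell K) x)
        + ∑ K ∈ S, bdryInt K fun F n x =>
            (qbar F).val x * inner ℝ (vval (jumpPoly T u K F) x) n := by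
  classical
  have hin : ∀ (w : Fin m → MPoly m) (n : Pt m), Continuous (fun x => (inner ℝ (vval w x) n : ℝ)) :=
    fun w n => (continuous_vval w).inner continuous_const
  have h1 : ∀ K ∈ S, (bdryInt K fun F n x => (qbar F).val x * inner ℝ (vval (u.cell K) x) n)
      - (bdryInt K fun F n x =>
          if F ∈ T.interface then (qbar F).val x * inner ℝ (vval (u.facet F) x) n else 0)
      = bdryInt K fun F n x => (qbar F).val x * inner ℝ (vval (jumpPoly T u K F) x) n := by
    intro K hK
    rw [← (T.isSimplex (hS K hK)).bdryInt_sub hm]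
    · congr 1
      funext F n x
      by_cases hF : F ∈ T.interface
      · rw [if_pos hF, vval_jumpPoly_of_mem u K hF, inner_sub_left]; ring
      · rw [if_neg hF, vval_jumpPoly_of_notMem u K hF, sub_zero]
    · exact fun F n => (MPoly.continuous_val _).mul (hin _ n)
    · intro F n
      by_cases hF : F ∈ T.interface
      · simp only [if_pos hF]
        exact (MPoly.continuous_val _).mul (hin _ n)
      · simp only [if_neg hF]
        exact continuous_const
  rw [← Finset.sum_congr rfl h1, Finset.sum_sub_distrib, formB, formBI]
  ring

/-- If the normal fluxes of `w` are orthogonal on every facet to the facet pressures, then their sum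
over the elements at a facet vanishes: it is itself an admissible facet pressure. -/
lemma sum_bdryInt_mul_eq_zero (hm : 0 < m) {S : Finset (Finset (Pt m))}
    (hS : ∀ K ∈ S, IsSimplex K) {l : ℕ} (w : Finset (Pt m) → Finset (Pt m) → Fin m → MPoly m)
    (hw : ∀ F ∈ facetsOf S, ∀ K ∈ S, ∀ j, w K F j ∈ Pk m l)
    (htest : ∀ q : Finset (Pt m) → MPoly m, (∀ F ∈ facetsOf S, q F ∈ Pk m l) →
      ∑ K ∈ S, bdryInt K (fun F n x => (q F).val x * inner ℝ (vval (w K F) x) n) = 0)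
    (φ : Finset (Pt m) → Pt m → ℝ) (hφ : ∀ F, Continuous (φ F)) :
    ∑ K ∈ S, bdryInt K (fun F n x => φ F x * inner ℝ (vval (w K F) x) n) = 0 := by
  let R : Finset (Pt m) → MPoly m := fun F =>
    ∑ i ∈ sides S F, ∑ j, (outwardNormal i.1 i.2 j) • w i.1 F j
  have hR : ∀ F x, (R F).val x
      = ∑ i ∈ sides S F, inner ℝ (vval (w i.1 F) x) (outwardNormal i.1 i.2) := by
    intro F x
    simp [R, inner_vval, mul_comm]
  have hRmem : ∀ F ∈ facetsOf S, R F ∈ Pk m l := by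
    intro F hF
    refine Submodule.sum_mem _ fun i hi => Submodule.sum_mem _ fun j _ =>
      Submodule.smul_mem _ _ (hw F hF _ (mem_sides.1 hi).1 j)
  have hint : ∀ F ∈ facetsOf S, ∀ f : Pt m → ℝ, Continuous f →
      IntegrableOn f (hull F) (μHE[m - 1] : Measure (Pt m)) := by
    intro F hF f hf
    obtain ⟨K, hK, v, hv, rfl⟩ := mem_facetsOf.1 hF
    exact (hS K hK).integrableOn_facet hm hv hf
  have hgroup : ∀ g : Finset (Pt m) → Pt m → ℝ, (∀ F, Continuous (g F)) →
      ∑ K ∈ S, bdryInt K (fun F n x => g F x * inner ℝ (vval (w K F) x) n)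
        = ∑ F ∈ facetsOf S, surfInt (hull F) (fun x => g F x * (R F).val x) := by
    intro g hg
    rw [sum_bdryInt_eq_sum_facets]
    refine Finset.sum_congr rfl fun F hF => ?_
    simp only [hR, Finset.mul_sum]
    unfold surfInt
    rw [integral_finsetSum]
    intro i _
    exact hint F hF _ ((hg F).mul ((continuous_vval _).inner continuous_const))
  have hsq : ∑ F ∈ facetsOf S, surfInt (hull F) (fun x => (R F).val x * (R F).val x) = 0 := by
    rw [← hgroup (fun F => (R F).val) (fun F => MPoly.continuous_val _)]
    exact htest R hRmem
  rw [Finset.sum_eq_zero_iff_of_nonneg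
    (fun F _ => integral_nonneg fun x => mul_self_nonneg _)] at hsq
  rw [hgroup φ hφ]
  refine Finset.sum_eq_zero fun F hF => ?_
  have h1 : (fun x => (R F).val x * (R F).val x)
      =ᵐ[(μHE[m - 1] : Measure (Pt m)).restrict (hull F)] 0 :=
    (setIntegral_eq_zero_iff_of_nonneg_ae
      (Filter.Eventually.of_forall fun x => mul_self_nonneg _)
      (hint F hF _ ((MPoly.continuous_val _).mul (MPoly.continuous_val _)))).1 (hsq F hF)
  unfold surfInt
  refine integral_eq_zero_of_ae ?_
  filter_upwards [h1] with x hx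
  have hx0 : (R F).val x = 0 := mul_self_eq_zero.1 hx
  simp [hx0]

section Flow

variable {T : Mesh m} {k : ℕ} {Ωs Ωd : Set (Pt m)} {P : FlowData m Ωs Ωd}
  {τ : Finset (Pt m) → Fin (m - 1) → Pt m} {β dt : ℝ} {u0 : Finset (Pt m) → Fin m → MPoly m}
  {c0 : Scalar m} {gi gp : Pt m → ℝ} {u : Velocity m} {p : Pressure m}

lemma SolvesFlow.jumpPoly_mem (h : SolvesFlow T k P τ β dt u0 c0 gi gp u p) {K F : Finset (Pt m)}
    (hK : K ∈ T.elements) (j : Fin m) : jumpPoly T u K F j ∈ Pk m (k + 1) := by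
  unfold jumpPoly
  refine Submodule.sub_mem _ (h.1.1 K hK j) ?_
  by_cases hF : F ∈ T.interface
  · rw [if_pos hF]
    exact h.1.2.1 F (by rw [Mesh.interface, Finset.mem_inter] at hF; exact hF.1) j
  · rw [if_neg hF]
    exact Submodule.zero_mem _

/-- **Conservation across facets**: the normal component of the discrete velocity is single valued
on interior facets and on the interface, and it vanishes on the outer boundary. Hence its integral
over all element boundaries against any function on the facets is zero. -/
lemma SolvesFlow.sum_bdryInt_flux_eq_zero (hm : 0 < m)
    (h : SolvesFlow T k P τ β dt u0 c0 gi gp u p) (φ : Finset (Pt m) → Pt m → ℝ)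
    (hφ : ∀ F, Continuous (φ F)) :
    ∑ K ∈ T.elements, bdryInt K (fun F n x => φ F x * inner ℝ (vval (u.cell K) x) n) = 0 := by
  classical
  have hs : ∀ K ∈ T.stokes, K ∈ T.elements := fun K hK => T.mem_elements.2 (Or.inl hK)
  have hd : ∀ K ∈ T.darcy, K ∈ T.elements := fun K hK => T.mem_elements.2 (Or.inr hK)
  have htotal : ∀ q : Pressure m, formBTotal T q u
      = (formB T.stokes q.cell q.facetS u + formBI T T.stokes q.facetS u)
        + (formB T.darcy q.cell q.facetD u + formBI T T.darcy q.facetD u) := fun q => rfl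
  have hS := sum_bdryInt_mul_eq_zero hm (fun K hK => T.isSimplex (hs K hK)) (l := k + 1)
    (jumpPoly T u) (fun F _ K hK j => h.jumpPoly_mem (hs K hK) j) (fun q hq => by
      have hq' : MemQ T k (⟨fun _ => 0, q, fun _ => 0⟩ : Pressure m) :=
        ⟨fun K _ => Submodule.zero_mem _, by simp [cellInt], hq, fun F _ => Submodule.zero_mem _⟩
      have h1 := h.formBTotal_eq hq'
      rw [htotal, formB_add_formBI hm T hs, formB_add_formBI hm T hd] at h1
      simpa using h1) φ hφ
  have hD := sum_bdryInt_mul_eq_zero hm (fun K hK => T.isSimplex (hd K hK)) (l := k + 1)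
    (jumpPoly T u) (fun F _ K hK j => h.jumpPoly_mem (hd K hK) j) (fun q hq => by
      have hq' : MemQ T k (⟨fun _ => 0, fun _ => 0, q⟩ : Pressure m) :=
        ⟨fun K _ => Submodule.zero_mem _, by simp [cellInt], fun F _ => Submodule.zero_mem _, hq⟩
      have h1 := h.formBTotal_eq hq'
      rw [htotal, formB_add_formBI hm T hs, formB_add_formBI hm T hd] at h1
      simpa using h1) φ hφ
  have hjump : ∑ K ∈ T.elements, bdryInt K
      (fun F n x => φ F x * inner ℝ (vval (jumpPoly T u K F) x) n) = 0 := by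
    rw [T.sum_elements, hS, hD, add_zero]
  have hin : ∀ (w : Fin m → MPoly m) (n : Pt m), Continuous (fun x => (inner ℝ (vval w x) n : ℝ)) :=
    fun w n => (continuous_vval w).inner continuous_const
  -- the facet velocity on the interface enters with opposite normals from the two sides
  have hfacet : ∑ K ∈ T.elements, bdryInt K (fun F n x =>
      φ F x * inner ℝ (vval (fun j => if F ∈ T.interface then u.facet F j else 0) x) n) = 0 := by
    rw [sum_bdryInt_eq_sum_facets]
    refine Finset.sum_eq_zero fun F hF => ?_
    by_cases hFI : F ∈ T.interface
    · simp only [if_pos hFI]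
      unfold surfInt
      rw [← integral_finsetSum]
      · have h0 : ∀ x, ∑ i ∈ sides T.elements F,
            φ F x * inner ℝ (vval (fun j => u.facet F j) x) (outwardNormal i.1 i.2) = 0 := by
          intro x
          rw [← Finset.mul_sum, ← inner_sum, T.sum_outwardNormal_interface hm hFI, inner_zero_right,
            mul_zero]
        simp only [h0, integral_zero]
      · intro i _
        obtain ⟨K, hK, v, hv, rfl⟩ := mem_facetsOf.1 hF
        exact (T.isSimplex hK).integrableOn_facet hm hv ((hφ _).mul (hin _ _))
    · simp [if_neg hFI]
  have hsplit : ∀ K ∈ T.elements, bdryInt K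
      (fun F n x => φ F x * inner ℝ (vval (u.cell K) x) n)
      = bdryInt K (fun F n x => φ F x * inner ℝ (vval (jumpPoly T u K F) x) n)
        + bdryInt K (fun F n x => φ F x *
            inner ℝ (vval (fun j => if F ∈ T.interface then u.facet F j else 0) x) n) := by
    intro K hK
    rw [← (T.isSimplex hK).bdryInt_add hm
      (f := fun F n x => φ F x * inner ℝ (vval (jumpPoly T u K F) x) n)
      (g := fun F n x => φ F x *
        inner ℝ (vval (fun j => if F ∈ T.interface then u.facet F j else 0) x) n)
      (fun F n => (hφ F).mul (hin _ n)) (fun F n => (hφ F).mul (hin _ n))]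
    congr 1
    funext F n x
    rw [← mul_add, ← inner_add_left]
    congr 2
    by_cases hF : F ∈ T.interface
    · simp [vval_jumpPoly_of_mem u K hF, hF]
    · simp [vval_jumpPoly_of_notMem u K hF, hF]
  rw [Finset.sum_congr rfl hsplit, Finset.sum_add_distrib, hjump, hfacet, add_zero]

lemma SolvesFlow.sum_cellInt_vdiv_eq_zero (hm : 0 < m)
    (h : SolvesFlow T k P τ β dt u0 c0 gi gp u p) :
    ∑ K ∈ T.elements, cellInt K (vdiv (u.cell K)) = 0 := by
  rw [← h.sum_bdryInt_flux_eq_zero hm (fun _ _ => 1) (fun _ => continuous_const)]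
  refine Finset.sum_congr rfl fun K hK => ?_
  obtain ⟨b⟩ := (T.isSimplex hK).nonempty_baryCoords
  rw [b.cellInt_vdiv (by have := (T.isSimplex hK).card; omega)]
  simp only [one_mul]

lemma isCompact_region (S : Finset (Finset (Pt m))) : IsCompact (region S) :=
  S.isCompact_biUnion fun K _ => isCompact_hull K

/-- The balance of the wells, element by element: the Darcy elements overlap in null sets only. -/
lemma AdmissibleWells.sum_cellInt_eq_zero (hm : 0 < m)
    (hg : AdmissibleWells (region T.darcy) gi gp) :
    ∑ K ∈ T.darcy, cellInt K (fun x => gi x - gp x) = 0 := by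
  have : IsFiniteMeasure ((volume : Measure (Pt m)).restrict (region T.darcy)) :=
    ⟨by rw [Measure.restrict_apply_univ]; exact (isCompact_region _).measure_lt_top⟩
  have hint : IntegrableOn (fun x => gi x - gp x) (region T.darcy) :=
    (hg.inj_memLp.integrable one_le_two).sub (hg.prod_memLp.integrable one_le_two)
  have hreg : region T.darcy = ⋃ K : T.darcy, hull (K : Finset (Pt m)) := by
    ext x; simp [region]
  have hd : ∀ K ∈ T.darcy, K ∈ T.elements := fun K hK => T.mem_elements.2 (Or.inr hK)
  rw [← hg.balance, ← Finset.sum_coe_sort]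
  rw [hreg] at hint ⊢
  rw [integral_iUnion_ae (fun K => (measurableSet_hull _).nullMeasurableSet) _ hint, tsum_fintype]
  · rfl
  · intro K K' hne
    exact T.volume_inter_eq_zero hm (hd _ K.2) (hd _ K'.2) (fun h => hne (Subtype.ext h))

/-- The divergence of a polynomial field, as a polynomial. -/
def divPoly (w : Fin m → MPoly m) : MPoly m := ∑ i, MvPolynomial.pderiv i (w i)

lemma val_divPoly (w : Fin m → MPoly m) (x : Pt m) : (divPoly w).val x = vdiv w x := by
  simp [divPoly, vdiv]

open scoped Classical in
/-- The discrete velocity is divergence free on the Stokes elements. -/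
lemma SolvesFlow.vdiv_ae_eq_zero (hm : 0 < m) (h : SolvesFlow T k P τ β dt u0 c0 gi gp u p)
    (hg : AdmissibleWells (region T.darcy) gi gp) {K₀ : Finset (Pt m)} (hK₀ : K₀ ∈ T.stokes) :
    ∀ᵐ x ∂(volume.restrict (hull K₀)), vdiv (u.cell K₀) x = 0 := by
  have hs : ∀ K ∈ T.stokes, K ∈ T.elements := fun K hK => T.mem_elements.2 (Or.inl hK)
  have hd : ∀ K ∈ T.darcy, K ∈ T.elements := fun K hK => T.mem_elements.2 (Or.inr hK)
  set V : ℝ := ∑ K ∈ T.elements, (volume : Measure (Pt m)).real (hull K) with hV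
  have hVK : (volume : Measure (Pt m)).real (hull K₀) ≤ V :=
    Finset.single_le_sum (f := fun K => (volume : Measure (Pt m)).real (hull K))
      (fun K _ => measureReal_nonneg) (hs K₀ hK₀)
  -- in a null region the claim is empty; otherwise constants can be used to adjust the mean
  by_cases hV0 : V = 0
  · have h0 : (volume : Measure (Pt m)).real (hull K₀) = 0 :=
      le_antisymm (hVK.trans hV0.le) measureReal_nonneg
    have h1 : (volume : Measure (Pt m)) (hull K₀) = 0 :=
      (measureReal_eq_zero_iff (isCompact_hull K₀).measure_lt_top.ne).1 h0
    rw [Measure.restrict_eq_zero.2 h1]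
    exact ae_zero.symm ▸ Filter.eventually_bot
  -- the test pressure: the divergence on `K₀`, corrected by a constant to have mean zero
  set I₀ := cellInt K₀ (vdiv (u.cell K₀)) with hI₀
  set c : ℝ := I₀ / V with hc
  set q : Finset (Pt m) → MPoly m := fun K =>
    (if K = K₀ then divPoly (u.cell K₀) else 0) - MvPolynomial.C c with hqdef
  have hval : ∀ K x, (q K).val x = (if K = K₀ then vdiv (u.cell K₀) x else 0) - c := by
    intro K x
    by_cases hK : K = K₀ <;> simp [hqdef, hK, val_divPoly]
  have hcI : ∀ (K : Finset (Pt m)) (f : Pt m → ℝ), Continuous f → IntegrableOn f (hull K) :=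
    fun K f hf => hf.continuousOn.integrableOn_compact (isCompact_hull K)
  have hmean : ∑ K ∈ T.elements, cellInt K (q K).val = 0 := by
    have h1 : ∀ K, cellInt K (q K).val
        = (if K = K₀ then I₀ else 0) - c * (volume : Measure (Pt m)).real (hull K) := by
      intro K
      have h2 : (q K).val = fun x => (if K = K₀ then vdiv (u.cell K₀) x else 0) - c :=
        funext (hval K)
      rw [h2, cellInt, integral_sub _ (hcI K _ continuous_const), setIntegral_const, smul_eq_mul,
        mul_comm c]
      · by_cases hK : K = K₀
        · subst hK; simp [hI₀, cellInt]
        · simp [hK]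
      · by_cases hK : K = K₀
        · simp only [if_pos hK]; exact hcI K _ (continuous_vdiv _)
        · simp only [if_neg hK]; exact hcI K _ continuous_const
    simp only [h1, Finset.sum_sub_distrib, ← Finset.mul_sum, ← hV, Finset.sum_ite_eq',
      if_pos (hs K₀ hK₀)]
    rw [hc, div_mul_cancel₀ _ hV0, sub_self]
  have hqmem : MemQ T k (⟨q, fun _ => 0, fun _ => 0⟩ : Pressure m) := by
    refine ⟨fun K _ => Submodule.sub_mem _ ?_ (MPoly.C_mem_Pk k c), hmean,
      fun F _ => Submodule.zero_mem _, fun F _ => Submodule.zero_mem _⟩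
    by_cases hK : K = K₀
    · rw [if_pos hK]
      exact Submodule.sum_mem _ fun i _ => MPoly.pderiv_mem_Pk (h.1.1 K₀ (hs K₀ hK₀) i) i
    · rw [if_neg hK]
      exact Submodule.zero_mem _
  have h1 := h.formBTotal_eq hqmem
  have htotal : formBTotal T ⟨q, fun _ => 0, fun _ => 0⟩ u
      = -∑ K ∈ T.elements, cellInt K (fun x => (q K).val x * vdiv (u.cell K) x) := by
    have h2 : formBTotal T ⟨q, fun _ => 0, fun _ => 0⟩ u
      = (formB T.stokes q (fun _ => 0) u + formBI T T.stokes (fun _ => 0) u)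
        + (formB T.darcy q (fun _ => 0) u + formBI T T.darcy (fun _ => 0) u) := rfl
    rw [h2, formB_add_formBI hm T hs, formB_add_formBI hm T hd, T.sum_elements]
    simp
    ring
  have hleft : ∑ K ∈ T.elements, cellInt K (fun x => (q K).val x * vdiv (u.cell K) x)
      = cellInt K₀ (fun x => vdiv (u.cell K₀) x ^ 2) := by
    have h2 : ∀ K, cellInt K (fun x => (q K).val x * vdiv (u.cell K) x)
        = (if K = K₀ then cellInt K₀ (fun x => vdiv (u.cell K₀) x ^ 2) else 0)
          - c * cellInt K (vdiv (u.cell K)) := by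
      intro K
      have h3 : (fun x => (q K).val x * vdiv (u.cell K) x)
          = fun x => (if K = K₀ then vdiv (u.cell K₀) x ^ 2 else 0) - c * vdiv (u.cell K) x := by
        funext x
        by_cases hK : K = K₀
        · subst hK; simp [hval]; ring
        · simp [hval, hK]
      have h4 : Continuous (fun x => c * vdiv (u.cell K) x) :=
        continuous_const.mul (continuous_vdiv _)
      rw [h3, cellInt, integral_sub _ (hcI K _ h4), integral_const_mul]
      · by_cases hK : K = K₀
        · subst hK; simp [cellInt]
        · simp [hK, cellInt]
      · by_cases hK : K = K₀
        · simp only [if_pos hK]; exact hcI K _ ((continuous_vdiv _).pow 2)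
        · simp only [if_neg hK]; exact hcI K _ continuous_const
    simp only [h2, Finset.sum_sub_distrib, ← Finset.mul_sum, h.sum_cellInt_vdiv_eq_zero hm,
      Finset.sum_ite_eq', if_pos (hs K₀ hK₀), mul_zero, sub_zero]
  have hright : ∑ K ∈ T.darcy, cellInt K (fun x => (gp x - gi x) * (q K).val x) = 0 := by
    have h2 : ∀ K ∈ T.darcy, cellInt K (fun x => (gp x - gi x) * (q K).val x)
        = c * cellInt K (fun x => gi x - gp x) := by
      intro K hK
      have hne : K ≠ K₀ := fun hKK => T.disj K₀ hK₀ (hKK ▸ hK)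
      rw [cellInt, cellInt, ← integral_const_mul]
      congr 1
      funext x
      rw [hval, if_neg hne]
      ring
    rw [Finset.sum_congr rfl h2, ← Finset.mul_sum, hg.sum_cellInt_eq_zero hm, mul_zero]
  rw [htotal, hleft, hright, neg_eq_zero] at h1
  have h2 := (setIntegral_eq_zero_iff_of_nonneg_ae
    (Filter.Eventually.of_forall fun x => sq_nonneg (vdiv (u.cell K₀) x))
    (hcI K₀ _ ((continuous_vdiv _).pow 2))).1 h1
  filter_upwards [h2] with x hx
  exact pow_eq_zero_iff two_ne_zero |>.1 hx

end Flow

/-! ### The advective form -/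

lemma integrableOn_hull (K : Finset (Pt m)) {f : Pt m → ℝ} (hf : Continuous f) :
    IntegrableOn f (hull K) := hf.continuousOn.integrableOn_compact (isCompact_hull K)

lemma bdryInt_mono {K : Finset (Pt m)} (hK : IsSimplex K) (hm : 0 < m)
    {f g : Finset (Pt m) → Pt m → Pt m → ℝ} (hf : ∀ F n, Continuous (f F n))
    (hg : ∀ F n, Continuous (g F n))
    (h : ∀ F n x, ‖n‖ = 1 → x ∈ hull K → f F n x ≤ g F n x) : bdryInt K f ≤ bdryInt K g :=
  Finset.sum_le_sum fun v hv => setIntegral_mono_on (hK.integrableOn_facet hm hv (hf _ _))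
    (hK.integrableOn_facet hm hv (hg _ _)) (measurableSet_hull _) fun x hx =>
      h _ _ x (hK.norm_outwardNormal hm hv) (BaryCoords.hull_opp_subset v hx)

lemma inflowInt_le {K : Finset (Pt m)} (hK : IsSimplex K) (hm : 0 < m) {b : Pt m → Pt m}
    (hb : Continuous b) {z : Finset (Pt m) → Pt m → ℝ} (hz : ∀ F, Continuous (z F)) :
    inflowInt K b (fun F n x => inner ℝ (b x) n * z F x * z F x)
      ≤ bdryInt K (fun F n x => 1 / 2 * (inner ℝ (b x) n * z F x * z F x)) := by
  refine Finset.sum_le_sum fun v hv => ?_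
  set n := outwardNormal K v
  have hbn : Continuous (fun x => (inner ℝ (b x) n : ℝ)) := hb.inner continuous_const
  have hfc : Continuous (fun x => (inner ℝ (b x) n : ℝ) * z (opp K v) x * z (opp K v) x) :=
    (hbn.mul (hz _)).mul (hz _)
  have hA : MeasurableSet {x | inner ℝ (b x) n < (0 : ℝ)} :=
    (isOpen_lt hbn continuous_const).measurableSet
  rw [surfInt, surfInt, ← setIntegral_indicator hA]
  refine setIntegral_mono_on ((hK.integrableOn_facet hm hv hfc).indicator hA)
    (hK.integrableOn_facet hm hv (hfc.const_mul _)) (measurableSet_hull _) fun x _ => ?_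
  have hz0 := mul_self_nonneg (z (opp K v) x)
  by_cases hx : inner ℝ (b x) n < (0 : ℝ)
  · rw [Set.indicator_of_mem (show x ∈ {x | inner ℝ (b x) n < (0 : ℝ)} from hx)]
    beta_reduce
    rw [mul_assoc]
    linarith [mul_nonpos_of_nonpos_of_nonneg hx.le hz0]
  · rw [Set.indicator_of_notMem (show x ∉ {x | inner ℝ (b x) n < (0 : ℝ)} from hx)]
    beta_reduce
    rw [mul_assoc]
    linarith [mul_nonneg (not_lt.1 hx) hz0]

/-- On one element the advective form controls half the divergence term, up to half the flux of
`w̄²` through the boundary: the flux terms combine to `½ |u·n| (w - w̄)² - ½ u·n w̄²`. -/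
lemma advective_element {K : Finset (Pt m)} (hK : IsSimplex K) (hm : 0 < m)
    (u : Fin m → MPoly m) (c : MPoly m) (cbar : Finset (Pt m) → MPoly m) :
    1 / 2 * cellInt K (fun x => vdiv u x * c.val x ^ 2)
        - 1 / 2 * bdryInt K (fun F n x => (cbar F).val x ^ 2 * inner ℝ (vval u x) n)
      ≤ -cellInt K (fun x => c.val x * inner ℝ (vval u x) (c.grad x))
        + bdryInt K (fun F n x => c.val x * inner ℝ (vval u x) n * (c.val x - (cbar F).val x))
        - inflowInt K (vval u) (fun F n x => inner ℝ (vval u x) n * (c.val x - (cbar F).val x)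
            * (c.val x - (cbar F).val x)) := by
  obtain ⟨b⟩ := hK.nonempty_baryCoords
  have hcc := MPoly.continuous_val c
  have hcb := fun F => MPoly.continuous_val (cbar F)
  have hun : ∀ n : Pt m, Continuous (fun x => (inner ℝ (vval u x) n : ℝ)) :=
    fun n => (continuous_vval u).inner continuous_const
  -- the divergence theorem for the field `c² u`
  have hdiv := b.cellInt_vdiv (by have := hK.card; omega) (fun i => u i * (c * c))
  have hv1 : vdiv (fun i => u i * (c * c))
      = fun x => vdiv u x * c.val x ^ 2 + 2 * (c.val x * inner ℝ (vval u x) (c.grad x)) := by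
    funext x
    rw [real_inner_comm, MPoly.inner_grad]
    simp only [vdiv, Derivation.leibniz, smul_eq_mul, MPoly.val_add, MPoly.val_mul,
      Finset.sum_add_distrib, Finset.sum_mul, Finset.mul_sum, vval]
    rw [add_comm]
    congr 1
    · exact Finset.sum_congr rfl fun i _ => by ring
    · exact Finset.sum_congr rfl fun i _ => by ring
  have hv2 : ∀ x n, (inner ℝ (vval (fun i => u i * (c * c)) x) n : ℝ)
      = c.val x ^ 2 * inner ℝ (vval u x) n := by
    intro x n
    simp only [inner_vval, MPoly.val_mul, Finset.mul_sum]
    exact Finset.sum_congr rfl fun i _ => by ring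
  simp only [hv2] at hdiv
  have hcont1 : Continuous (fun x => vdiv u x * c.val x ^ 2) := (continuous_vdiv u).mul (hcc.pow 2)
  have hcont2 : Continuous (fun x => c.val x * (inner ℝ (vval u x) (c.grad x) : ℝ)) :=
    hcc.mul ((continuous_vval u).inner (MPoly.continuous_grad c))
  rw [hv1, cellInt, integral_add (integrableOn_hull K hcont1)
    (integrableOn_hull K (hcont2.const_mul 2)), integral_const_mul] at hdiv
  have hin := inflowInt_le hK hm (continuous_vval u)
    (z := fun F x => c.val x - (cbar F).val x) (fun F => hcc.sub (hcb F))
  have hbd : bdryInt K (fun F n x => c.val x * inner ℝ (vval u x) n * (c.val x - (cbar F).val x))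
      - bdryInt K (fun F n x => 1 / 2 * (inner ℝ (vval u x) n * (c.val x - (cbar F).val x)
            * (c.val x - (cbar F).val x)))
      = 1 / 2 * bdryInt K (fun _ n x => c.val x ^ 2 * inner ℝ (vval u x) n)
        - 1 / 2 * bdryInt K (fun F n x => (cbar F).val x ^ 2 * inner ℝ (vval u x) n) := by
    rw [← bdryInt_const_mul, ← bdryInt_const_mul, ← hK.bdryInt_sub hm, ← hK.bdryInt_sub hm]
    · congr 1
      funext F n x
      ring
    · exact fun F n => continuous_const.mul ((hcc.pow 2).mul (hun n))
    · exact fun F n => continuous_const.mul (((hcb F).pow 2).mul (hun n))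
    · exact fun F n => (hcc.mul (hun n)).mul (hcc.sub (hcb F))
    · exact fun F n => continuous_const.mul
        (((hun n).mul (hcc.sub (hcb F))).mul (hcc.sub (hcb F)))
  unfold cellInt
  linarith

/-! ### The diffusive form -/

lemma norm_mulE_le (A : Matrix (Fin m) (Fin m) ℝ) (ξ : Pt m) : ‖mulE A ξ‖ ≤ frobNorm A * ‖ξ‖ := by
  have h1 : ‖mulE A ξ‖ ^ 2 ≤ (∑ i, ∑ j, A i j ^ 2) * ‖ξ‖ ^ 2 := by
    rw [EuclideanSpace.real_norm_sq_eq, EuclideanSpace.real_norm_sq_eq, Finset.sum_mul]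
    refine Finset.sum_le_sum fun i _ => ?_
    simp only [mulE, Matrix.mulVec, dotProduct]
    exact Finset.sum_mul_sq_le_sq_mul_sq _ _ _
  have h0 : 0 ≤ ∑ i, ∑ j, A i j ^ 2 :=
    Finset.sum_nonneg fun i _ => Finset.sum_nonneg fun j _ => sq_nonneg _
  have h2 : frobNorm A ^ 2 = ∑ i, ∑ j, A i j ^ 2 := Real.sq_sqrt h0
  have h3 : 0 ≤ frobNorm A := Real.sqrt_nonneg _
  refine (sq_le_sq₀ (norm_nonneg _) (mul_nonneg h3 (norm_nonneg _))).1 ?_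
  rw [mul_pow, h2]
  exact h1

lemma abs_le_frobNorm (A : Matrix (Fin m) (Fin m) ℝ) (i j : Fin m) : |A i j| ≤ frobNorm A := by
  refine Real.abs_le_sqrt ?_
  exact (Finset.single_le_sum (f := fun j => A i j ^ 2) (fun j _ => sq_nonneg _)
    (Finset.mem_univ j)).trans (Finset.single_le_sum (f := fun i => ∑ j, A i j ^ 2)
      (fun i _ => Finset.sum_nonneg fun j _ => sq_nonneg _) (Finset.mem_univ i))

lemma IsDispersionTensor.continuous {D : Pt m → Matrix (Fin m) (Fin m) ℝ} {Dmin CD : ℝ}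
    (hD : IsDispersionTensor D Dmin CD) (hCD : 0 ≤ CD) : Continuous D := by
  refine continuous_pi fun i => continuous_pi fun j => ?_
  refine (LipschitzWith.of_dist_le_mul (K := ⟨CD, hCD⟩) fun x y => ?_).continuous
  rw [Real.dist_eq, dist_eq_norm]
  exact (abs_le_frobNorm (D x - D y) i j).trans (hD.lipschitz x y)

lemma continuous_mulE {A : Pt m → Matrix (Fin m) (Fin m) ℝ} (hA : Continuous A)
    {g : Pt m → Pt m} (hg : Continuous g) : Continuous (fun x => mulE (A x) (g x)) := by
  unfold mulE
  exact (PiLp.continuous_toLp 2 _).comp (hA.matrix_mulVec (by fun_prop))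

/-- On one element, a sufficiently large penalty makes the diffusive form coercive: the consistency
terms are absorbed with the trace inequality for `∇w` and Young's inequality. -/
lemma diffusive_element {K : Finset (Pt m)} (hK : IsSimplex K) (hm : 0 < m)
    {A : Pt m → Matrix (Fin m) (Fin m) ℝ} (hA : Continuous A) {D₀ D₁ Ct β : ℝ} (hD₀ : 0 < D₀)
    (hCt : 0 ≤ Ct) (hell : ∀ x ξ, D₀ * ‖ξ‖ ^ 2 ≤ inner ℝ ξ (mulE (A x) ξ))
    (hbd : ∀ x ∈ hull K, ∀ ξ, ‖mulE (A x) ξ‖ ≤ D₁ * ‖ξ‖) (c : MPoly m)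
    (cbar : Finset (Pt m) → MPoly m)
    (htr : bdryInt K (fun _ _ x => ‖c.grad x‖ ^ 2)
      ≤ Ct * (diamK K)⁻¹ * cellInt K (fun x => ‖c.grad x‖ ^ 2))
    (hβ : 1 / 2 + 2 * D₁ ^ 2 * (Ct + 1) / D₀ ^ 2 ≤ β) :
    D₀ / 2 * (cellInt K (fun x => ‖c.grad x‖ ^ 2)
        + (diamK K)⁻¹ * bdryInt K (fun F _ x => (c.val x - (cbar F).val x) ^ 2))
      ≤ cellInt K (fun x => inner ℝ (mulE (A x) (c.grad x)) (c.grad x))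
        + β / diamK K * bdryInt K (fun F n x =>
            inner ℝ ((c.val x - (cbar F).val x) • mulE (A x) n) ((c.val x - (cbar F).val x) • n))
        - bdryInt K (fun F n x =>
            inner ℝ (mulE (A x) (c.grad x)) n * (c.val x - (cbar F).val x))
        - bdryInt K (fun F n x =>
            inner ℝ (mulE (A x) (c.grad x)) n * (c.val x - (cbar F).val x)) := by
  have hh : 0 < diamK K := hK.diamK_pos hm
  set h := diamK K with hhdef
  have hcc := MPoly.continuous_val c
  have hgc := MPoly.continuous_grad c
  have hzc : ∀ F, Continuous (fun x => c.val x - (cbar F).val x) :=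
    fun F => hcc.sub (MPoly.continuous_val (cbar F))
  have hAg := continuous_mulE hA hgc
  have hflux : ∀ (F : Finset (Pt m)) (n : Pt m), Continuous (fun x =>
      (inner ℝ (mulE (A x) (c.grad x)) n : ℝ) * (c.val x - (cbar F).val x)) :=
    fun F n => (hAg.inner continuous_const).mul (hzc F)
  set X := cellInt K (fun x => ‖c.grad x‖ ^ 2) with hX
  set Y := bdryInt K (fun F _ x => (c.val x - (cbar F).val x) ^ 2) with hY
  have hX0 : 0 ≤ X := integral_nonneg fun x => sq_nonneg _
  have hY0 : 0 ≤ Y := Finset.sum_nonneg fun v _ => integral_nonneg fun x => sq_nonneg _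
  have hβ0 : 0 ≤ β := le_trans (by positivity) hβ
  have h1 : D₀ * X ≤ cellInt K (fun x => inner ℝ (mulE (A x) (c.grad x)) (c.grad x)) := by
    rw [hX, cellInt, ← integral_const_mul]
    refine setIntegral_mono_on (integrableOn_hull K ((hgc.norm.pow 2).const_mul D₀))
      (integrableOn_hull K (hAg.inner hgc)) (measurableSet_hull K) fun x _ => ?_
    rw [real_inner_comm]
    exact hell x _
  have h2 : D₀ * Y ≤ bdryInt K (fun F n x =>
      inner ℝ ((c.val x - (cbar F).val x) • mulE (A x) n) ((c.val x - (cbar F).val x) • n)) := by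
    rw [hY, ← bdryInt_const_mul]
    refine bdryInt_mono hK hm (fun F n => ((hzc F).pow 2).const_mul D₀)
      (fun F n => ((hzc F).smul (continuous_mulE hA continuous_const)).inner
        ((hzc F).smul continuous_const)) fun F n x hn _ => ?_
    have h3 := hell x n
    rw [hn, one_pow, mul_one, real_inner_comm] at h3
    rw [inner_smul_left, inner_smul_right, RCLike.conj_to_real, ← mul_assoc, ← pow_two, mul_comm]
    exact mul_le_mul_of_nonneg_left h3 (sq_nonneg _)
  -- the weight in Young's inequality, chosen so that the trace term costs at most `D₀ / 2`
  set ε : ℝ := h * D₀ / (2 * (Ct + 1)) with hε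
  have hε0 : 0 < ε := by positivity
  have h3 : 2 * bdryInt K (fun F n x =>
      inner ℝ (mulE (A x) (c.grad x)) n * (c.val x - (cbar F).val x))
      ≤ ε * bdryInt K (fun _ _ x => ‖c.grad x‖ ^ 2) + D₁ ^ 2 / ε * Y := by
    have hc1 : ∀ (F : Finset (Pt m)) (n : Pt m), Continuous (fun x => ε * ‖c.grad x‖ ^ 2) :=
      fun F n => (hgc.norm.pow 2).const_mul ε
    have hc2 : ∀ (F : Finset (Pt m)) (n : Pt m), Continuous
        (fun x => D₁ ^ 2 / ε * (c.val x - (cbar F).val x) ^ 2) :=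
      fun F n => ((hzc F).pow 2).const_mul _
    rw [hY, ← bdryInt_const_mul, ← bdryInt_const_mul, ← bdryInt_const_mul,
      ← hK.bdryInt_add hm hc1 hc2]
    refine bdryInt_mono hK hm (fun F n => (hflux F n).const_mul 2)
      (fun F n => (hc1 F n).add (hc2 F n)) fun F n x hn hx => ?_
    set z := c.val x - (cbar F).val x
    have h4 : |inner ℝ (mulE (A x) (c.grad x)) n| ≤ D₁ * ‖c.grad x‖ := by
      refine (abs_real_inner_le_norm _ _).trans ?_
      rw [hn, mul_one]
      exact hbd x hx _
    have h5 : inner ℝ (mulE (A x) (c.grad x)) n * z ≤ D₁ * ‖c.grad x‖ * |z| := by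
      refine (le_abs_self _).trans ?_
      rw [abs_mul]
      exact mul_le_mul_of_nonneg_right h4 (abs_nonneg z)
    have h6 : 2 * (D₁ * ‖c.grad x‖ * |z|) ≤ ε * ‖c.grad x‖ ^ 2 + D₁ ^ 2 / ε * z ^ 2 := by
      have h7 : 0 ≤ (ε * ‖c.grad x‖ - D₁ * |z|) ^ 2 / ε := by positivity
      have h8 : (ε * ‖c.grad x‖ - D₁ * |z|) ^ 2 / ε
          = ε * ‖c.grad x‖ ^ 2 + D₁ ^ 2 / ε * |z| ^ 2 - 2 * (D₁ * ‖c.grad x‖ * |z|) := by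
        field_simp
        ring
      rw [h8, sq_abs] at h7
      linarith
    linarith
  have h4 : ε * bdryInt K (fun _ _ x => ‖c.grad x‖ ^ 2) ≤ D₀ / 2 * X := by
    refine (mul_le_mul_of_nonneg_left htr hε0.le).trans ?_
    have h5 : ε * (Ct * h⁻¹ * X) = D₀ / 2 * X * (Ct / (Ct + 1)) := by
      rw [hε]
      field_simp
    rw [h5]
    refine mul_le_of_le_one_right (by positivity) ?_
    rw [div_le_one (by positivity)]
    linarith
  have h5 : D₀ / 2 * (h⁻¹ * Y) + D₁ ^ 2 / ε * Y ≤ β / h * (D₀ * Y) := by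
    have h6 : D₀ / 2 * (h⁻¹ * Y) + D₁ ^ 2 / ε * Y
        = (1 / 2 + 2 * D₁ ^ 2 * (Ct + 1) / D₀ ^ 2) / h * (D₀ * Y) := by
      rw [hε]
      field_simp
    rw [h6]
    gcongr
  have h6 : β / h * (D₀ * Y) ≤ β / h * bdryInt K (fun F n x =>
      inner ℝ ((c.val x - (cbar F).val x) • mulE (A x) n) ((c.val x - (cbar F).val x) • n)) :=
    mul_le_mul_of_nonneg_left h2 (by positivity)
  linarith

/-- The discrete trace inequality for the gradient of a polynomial. -/
lemma bdryInt_grad_le {K : Finset (Pt m)} (hK : IsSimplex K) (hm : 0 < m) {k : ℕ} {C : ℝ}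
    (htr : ∀ p ∈ Pk m k, bdryInt K (fun _ _ x => MPoly.val p x ^ 2)
      ≤ C * cellInt K (fun x => MPoly.val p x ^ 2)) {c : MPoly m} (hc : c ∈ Pk m k) :
    bdryInt K (fun _ _ x => ‖c.grad x‖ ^ 2) ≤ C * cellInt K (fun x => ‖c.grad x‖ ^ 2) := by
  have hsq : ∀ x, ‖c.grad x‖ ^ 2 = ∑ i, MPoly.val (MvPolynomial.pderiv i c) x ^ 2 := by
    intro x
    rw [EuclideanSpace.real_norm_sq_eq]
    rfl
  have hcont : ∀ i, Continuous (fun x : Pt m => MPoly.val (MvPolynomial.pderiv i c) x ^ 2) :=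
    fun i => (MPoly.continuous_val _).pow 2
  have h1 : cellInt K (fun x => ‖c.grad x‖ ^ 2)
      = ∑ i, cellInt K (fun x => MPoly.val (MvPolynomial.pderiv i c) x ^ 2) := by
    simp only [hsq]
    exact integral_finsetSum _ fun i _ => integrableOn_hull K (hcont i)
  have h2 : bdryInt K (fun _ _ x => ‖c.grad x‖ ^ 2)
      = ∑ i, bdryInt K (fun _ _ x => MPoly.val (MvPolynomial.pderiv i c) x ^ 2) := by
    simp only [hsq, bdryInt]
    rw [Finset.sum_comm]
    exact Finset.sum_congr rfl fun v hv =>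
      integral_finsetSum _ fun i _ => hK.integrableOn_facet hm hv (hcont i)
  rw [h1, h2, Finset.mul_sum]
  exact Finset.sum_le_sum fun i _ =>
    htr _ (MPoly.pderiv_mem_Pk (MPoly.Pk_mono (Nat.le_succ k) hc) i)

end

end StokesDarcy

theorem mainTheorem9 (d Dmin M : ℝ) (hd : 0 < d) (hDmin : 0 < Dmin) (hM : 0 < M) :
    ∃ Ctr : ℝ, 0 < Ctr ∧
      ∀ (m : ℕ), (m = 2 ∨ m = 3) → ∀ (k : ℕ) (σ CD : ℝ), 0 < σ → 0 < CD →
      ∃ β₀ : ℝ, 0 < β₀ ∧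
        ∀ (D : Pt m → Matrix (Fin m) (Fin m) ℝ), IsDispersionTensor D Dmin CD →
        ∀ (T : Mesh m), T.ShapeRegular σ →
        ∀ (P : FlowData m (region T.stokes) (region T.darcy))
          (τ : Finset (Pt m) → Fin (m - 1) → Pt m), IsTangents T τ →
        ∀ (βs dt : ℝ), 0 < βs → 0 < dt →
        ∀ (u0 : Finset (Pt m) → Fin m → MPoly m) (c0 : Scalar m),
          MemVCell T (k + 1) u0 → MemC T k c0 →
        ∀ (gi gp : Pt m → ℝ), AdmissibleWells (region T.darcy) gi gp →
        ∀ (u : Velocity m) (p : Pressure m), SolvesFlow T k P τ βs dt u0 c0 gi gp u p →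
          (∀ K ∈ T.elements, ∀ x ∈ hull K, ‖vval (u.cell K) x‖ ≤ M) →
        ∀ (βtr : ℝ), β₀ < βtr → ∀ (w : Scalar m), MemC T k w →
          formBtr T d D βtr u.cell w w ≥
            Ctr * normCSq T w
              + (1 / 2) * ∑ K ∈ T.darcy,
                  cellInt K fun x => vdiv (u.cell K) x * (w.cell K).val x ^ 2 := by
  refine ⟨min d Dmin / 2, by positivity, fun m hm2 k σ CD hσ hCD => ?_⟩
  have hm : 0 < m := by omega
  obtain ⟨Ct, hCt, htrace⟩ := exists_trace_inequality hm k hσ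
  set D₀ := min d Dmin with hD₀
  have hD₀pos : 0 < D₀ := lt_min hd hDmin
  set D₁ := d + CD * (1 + M) with hD₁
  refine ⟨1 / 2 + 2 * D₁ ^ 2 * (Ct + 1) / D₀ ^ 2, by positivity, ?_⟩
  intro D hD T hT P τ _ βs dt _ _ u0 c0 _ _ gi gp hg u p hsol hbound βtr hβ w hw
  -- the advective part
  have hadv : 1 / 2 * ∑ K ∈ T.darcy, cellInt K (fun x => vdiv (u.cell K) x * (w.cell K).val x ^ 2)
      ≤ formBa T u.cell w w := by
    have h1 := Finset.sum_le_sum fun K (hK : K ∈ T.elements) =>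
      advective_element (T.isSimplex hK) hm (u.cell K) (w.cell K) w.facet
    have h2 := hsol.sum_bdryInt_flux_eq_zero hm (fun F x => (w.facet F).val x ^ 2)
      (fun F => (MPoly.continuous_val _).pow 2)
    have h3 : ∑ K ∈ T.stokes, cellInt K (fun x => vdiv (u.cell K) x * (w.cell K).val x ^ 2) = 0 := by
      refine Finset.sum_eq_zero fun K hK => integral_eq_zero_of_ae ?_
      filter_upwards [hsol.vdiv_ae_eq_zero hm hg hK] with x hx
      simp [hx]
    rw [Finset.sum_sub_distrib, ← Finset.mul_sum, ← Finset.mul_sum, h2, mul_zero, sub_zero,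
      T.sum_elements (fun K => cellInt K (fun x => vdiv (u.cell K) x * (w.cell K).val x ^ 2)), h3,
      zero_add, Finset.sum_sub_distrib, Finset.sum_add_distrib, Finset.sum_neg_distrib] at h1
    exact h1
  -- the diffusive part
  have hdiff : D₀ / 2 * normCSq T w ≤ formBd T d D βtr u.cell w w := by
    rw [normCSq, formBd, Finset.mul_sum, ← Finset.sum_add_distrib, ← Finset.sum_sub_distrib,
      ← Finset.sum_sub_distrib]
    refine Finset.sum_le_sum fun K hK => ?_
    have hsimp := T.isSimplex hK
    refine diffusive_element hsimp hm ?_ hD₀pos hCt ?_ (D₁ := D₁) ?_ (w.cell K) w.facet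
      (bdryInt_grad_le hsimp hm (htrace K hsimp (hT K hK)) (hw.1 K hK)) hβ.le
    · by_cases hs : K ∈ T.stokes
      · have h1 : Dtilde T d D u.cell K = fun _ => d • 1 := by
          funext x; rw [Dtilde, if_pos hs]
        rw [h1]
        exact continuous_const
      · have h1 : Dtilde T d D u.cell K = fun x => D (vval (u.cell K) x) := by
          funext x; rw [Dtilde, if_neg hs]
        rw [h1]
        exact (hD.continuous hCD.le).comp (continuous_vval _)
    · intro x ξ
      by_cases hs : K ∈ T.stokes
      · have h1 : mulE (d • (1 : Matrix (Fin m) (Fin m) ℝ)) ξ = d • ξ := by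
          ext i; simp [mulE, Matrix.smul_mulVec]
        rw [Dtilde, if_pos hs, h1, inner_smul_right, real_inner_self_eq_norm_sq]
        exact mul_le_mul_of_nonneg_right (min_le_left _ _) (sq_nonneg _)
      · rw [Dtilde, if_neg hs]
        exact (mul_le_mul_of_nonneg_right (min_le_right _ _) (sq_nonneg _)).trans (hD.elliptic _ ξ)
    · intro x hx ξ
      by_cases hs : K ∈ T.stokes
      · have h1 : mulE (d • (1 : Matrix (Fin m) (Fin m) ℝ)) ξ = d • ξ := by
          ext i; simp [mulE, Matrix.smul_mulVec]
        rw [Dtilde, if_pos hs, h1, norm_smul, Real.norm_of_nonneg hd.le]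
        refine mul_le_mul_of_nonneg_right ?_ (norm_nonneg _)
        have : 0 ≤ CD * (1 + M) := by positivity
        linarith
      · rw [Dtilde, if_neg hs]
        refine (norm_mulE_le _ ξ).trans (mul_le_mul_of_nonneg_right ?_ (norm_nonneg _))
        refine (hD.growth _).trans ?_
        have : CD * (1 + ‖vval (u.cell K) x‖) ≤ CD * (1 + M) :=
          mul_le_mul_of_nonneg_left (by linarith [hbound K hK x hx]) hCD.le
        linarith
  rw [ge_iff_le, formBtr]
  linarith
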